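/- Let $n,m\ge 0$ be integers and $l_1,\dots,l_n\in\mathbb Z$. Let $R=\mathbb Z[t_{i,j}:\ i,j\ge 0]$, let $I\subset R$ be the ideal generated by the $t_{i,j}$ with $0\le i\le j$, and let $\hat R_{\mathbb Q}=\hat R_I\hat\otimes_{\mathbb Z}\mathbb Q=\varprojlim_k (R/I^k)\otimes\mathbb Q$. For an $\hat R_{\mathbb Q}$-algebra $S$ we write $I^kS$ for the ideal of $S$ generated by the kernel of $\hat R_{\mathbb Q}\to (R/I^k)\otimes\mathbb Q$, and "$I$-adic" refers to this filtration. Consider the differential operator $$D=(x\partial_x-l_1)\cdots(x\partial_x-l_n)+\sum_{0\le j\le m,\ i\ge 0}t_{i,j}x^i\partial_x^j .$$ Let $B(\varepsilon)=(b_{ij}(\varepsilon))_{i,j\in\mathbb Z}$ be its matrix, $Dx^{j+\varepsilon}=\sum_i b_{ij}(\varepsilon)x^{i+\varepsilon}$, and let $w_{-M,N}(\varepsilon)$ be the Weierstrass polynomial of $\det (b_{ij}(\varepsilon))_{-M\le i,j\le N}$, i.e. the monic polynomial, with all non-leading coefficients in $I\hat R_{\mathbb Q}$, by which this determinant is divisible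 in $\hat R_{\mathbb Q}[[\varepsilon]]$ with invertible quotient. Let $w(\varepsilon)=\lim_{M,N\to\infty}w_{-M,N}(\varepsilon)$ be the $I$-adic limit, a monic polynomial of degree $n$, and let $$\overline R=\hat R_{\mathbb Q}[\varepsilon_1,\dots,\varepsilon_n]\Big/\Big\{\text{coefficients of } w(\varepsilon)-\prod_{j=1}^n(\varepsilon-\varepsilon_j)\Big\}.$$ For an $\hat R_{\mathbb Q}$-algebra $S$, $\delta\in S$ and $r_a\in S$ $(a\in\mathbb Z)$, the expression $x^\delta\sum_a r_ax^a$ denotes the formal series $\sum_{a\in\mathbb Z,\,k\ge 0}\delta^k r_a\,x^a\frac{(\log x)^k}{k!}$; it is a formal solution of $Dg=0$ if each coefficient of $Dg$, an infinite sum over $i$, converges $I$-adically to $0$. (1) The equation $Dg=0$ has formal solutions $g_j=x^{\varepsilon_j}\sum_{a\in\mathbb Z}r_{j,a}x^a$, $j=1,\dots,n$, with $r_{j,a}\in\overline R$, that are linearly independent over $\overline R$ and such that, for some constant $C\in\mathbb R$, $$r_{j,a}\in I^{\max\left(0,\left\lceil\frac{C-a}{\max(m,1)}\right\rceil\right)}\,\overline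 R\qquad\text{for all } j \text{ and } a .$$ In particular, if $n\ge 1$ and $m\le n$, then $r_{j,a}\in I^{\max(0,\lceil (C-a)/n\rceil)}\overline R$. Moreover the $g_j$ can be chosen so that, for every prime ideal $P\subset\overline R$ with $P\cap\hat R_{\mathbb Q}=0$, their images remain linearly independent over $\overline R/P$. (2) Conversely, let $P\subset\overline R$ be a prime ideal with $P\cap \hat R_{\mathbb Q}=0$ (for instance $P=0$ if $\overline R$ is an integral domain), so that $S=\overline R/P$ is a smallest integral domain extending $\hat R_{\mathbb Q}$ over which $w$ factorizes completely. Let $g=x^\delta\sum_{a\in\mathbb Z}r_ax^a$ with $\delta,r_a\in S$ be a non-zero formal solution of $Dg=0$ such that $\delta$ is nilpotent modulo $IS$ (in particular, $\delta\equiv 0$ mod $I$ is allowed) and such that there are constants $C_1,C_2,C_3>0$ with $r_a\in I^{\max(0,\lceil C_2-C_1a\rceil)}S$ for all $a<-C_3$. Then $\delta$ is the image in $S$ of $\varepsilon_j$ for some $j=1,\dots,n$. -/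

import Mathlib

noncomputable section

namespace PDet

/-- The polynomial ring `ℚ[t_{i,j} : i, j ≥ 0]`, i.e. `R ⊗ ℚ` for `R = ℤ[t_{i,j} : i, j ≥ 0]`. -/
abbrev PolyRing : Type := MvPolynomial (ℕ × ℕ) ℚ

/-- The ideal generated by the small parameters `t_{i,j}`, `0 ≤ i ≤ j`. -/
def smallIdeal : Ideal PolyRing :=
  Ideal.span {f | ∃ i j : ℕ, i ≤ j ∧ f = MvPolynomial.X (i, j)}

/-- The completed tensor product of the `I`-adic completion of `R` with `ℚ`, that is
`lim_k (R / I ^ k) ⊗ ℚ = lim_k ℚ[t] / I_ℚ ^ k` with `I_ℚ` the extension of `I` to `ℚ[t]`. -/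
abbrev RHat : Type := AdicCompletion smallIdeal PolyRing

/-- The parameter `t_{i,j}` as an element of the completion. -/
def t (i j : ℕ) : RHat := algebraMap PolyRing RHat (MvPolynomial.X (i, j))

/-- The `I`-adic filtration of the completion: the elements that vanish in `ℚ[t] / I_ℚ ^ k`. -/
def filt (k : ℕ) : Ideal RHat := RingHom.ker (AdicCompletion.evalₐ smallIdeal k)

/-- The `I`-adic filtration of an algebra `S` over the completion: the ideal "`I ^ k`" of `S`. -/
def filtIn (S : Type) [CommRing S] [Algebra RHat S] (k : ℕ) : Ideal S :=
  (filt k).map (algebraMap RHat S)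

/-! ### The infinite matrix of the operator and its regularized determinant -/

open Polynomial in
/-- The matrix `B(ε)` of the operator
`D = (x∂ - l_1)⋯(x∂ - l_n) + ∑_{0 ≤ k ≤ m, 0 ≤ i} t_{i,k} x^i ∂^k` in the basis `x^{i+ε}`, `i ∈ ℤ`:
`D x^{j+ε} = ∑_i b_{ij}(ε) x^{i+ε}`, where `∂^k x^{j+ε}` equals
`(j+ε)(j+ε-1)⋯(j+ε-k+1) x^{j+ε-k}`. The polynomial variable is `ε`. -/
def entry {n : ℕ} (l : Fin n → ℤ) (m : ℕ) (i j : ℤ) : RHat[X] :=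
  (if i = j then ∏ s : Fin n, (X + C ((j - l s : ℤ) : RHat)) else 0) +
    ∑ k ∈ Finset.range (m + 1),
      if 0 ≤ (k : ℤ) + i - j then
        C (t ((k : ℤ) + i - j).toNat k) *
          ∏ s ∈ Finset.range k, (X + C ((j - (s : ℤ) : ℤ) : RHat))
      else 0

open Polynomial in
/-- The determinant of the finite submatrix of `B(ε)` with rows and columns in `[-M, N]`. -/
def truncDet {n : ℕ} (l : Fin n → ℤ) (m M N : ℕ) : RHat[X] :=
  (Matrix.of fun i j : Finset.Icc (-(M : ℤ)) (N : ℤ) => entry l m i j).det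

open Polynomial Classical in
/-- The Weierstrass polynomial of `q`: the monic polynomial `p`, with all coefficients below the
leading one in `I`, such that `q = p * h` for an invertible power series `h` in `ε`
(`0` if there is no such polynomial). -/
def weierstrassPoly (q : RHat[X]) : RHat[X] :=
  if h : ∃ p : RHat[X], ∃ u : PowerSeries RHat,
      PowerSeries.IsWeierstrassFactorizationAt (q : PowerSeries RHat) p u (filt 1)
  then h.choose else 0

open Polynomial in
/-- `w` is the `I`-adic limit, as `M, N → ∞`, of the Weierstrass polynomials of the determinants
of the finite submatrices. -/
def IsRegularizedDet {n : ℕ} (l : Fin n → ℤ) (m : ℕ) (w : RHat[X]) : Prop :=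
  ∀ k : ℕ, ∃ K : ℕ, ∀ M N : ℕ, K ≤ M → K ≤ N → ∀ i : ℕ,
    (weierstrassPoly (truncDet l m M N)).coeff i - w.coeff i ∈ filt k

open Polynomial Classical in
/-- The polynomial `w(ε)`: the limit of the Weierstrass polynomials of the truncated
determinants (`0` if there is no limit). -/
def w {n : ℕ} (l : Fin n → ℤ) (m : ℕ) : RHat[X] :=
  if h : ∃ p : RHat[X], IsRegularizedDet l m p then h.choose else 0

/-! ### The universal extension in which `w` factorizes completely -/

/-- The ideal of relations `w(ε) = ∏_j (ε - ε_j)` in `RHat[ε_1, …, ε_n]`. -/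
def splitIdeal {n : ℕ} (l : Fin n → ℤ) (m : ℕ) : Ideal (MvPolynomial (Fin n) RHat) :=
  Ideal.span (Set.range fun k : ℕ =>
    ((w l m).map (MvPolynomial.C : RHat →+* MvPolynomial (Fin n) RHat) -
      ∏ j : Fin n, (Polynomial.X - Polynomial.C (MvPolynomial.X j))).coeff k)

/-- The ring obtained from `RHat` by adjoining universal roots `ε_1, …, ε_n` of `w`. -/
def RBar {n : ℕ} (l : Fin n → ℤ) (m : ℕ) : Type := MvPolynomial (Fin n) RHat ⧸ splitIdeal l m

instance {n : ℕ} (l : Fin n → ℤ) (m : ℕ) : CommRing (RBar l m) :=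
  inferInstanceAs (CommRing (MvPolynomial (Fin n) RHat ⧸ splitIdeal l m))

instance {n : ℕ} (l : Fin n → ℤ) (m : ℕ) : Algebra RHat (RBar l m) :=
  inferInstanceAs (Algebra RHat (MvPolynomial (Fin n) RHat ⧸ splitIdeal l m))

/-- The root `ε_j` of `w`. -/
def root {n : ℕ} (l : Fin n → ℤ) (m : ℕ) (j : Fin n) : RBar l m :=
  Ideal.Quotient.mk (splitIdeal l m) (MvPolynomial.X j)

/-! ### Formal expressions and formal solutions -/

/-- Formal expressions `∑_{a ∈ ℤ, k ≥ 0} f a k * x ^ a * (log x) ^ k / k!`, infinite in all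
directions. -/
abbrev LogSeries (S : Type) : Type := ℤ → ℕ → S

/-- The derivation `∂ = d/dx`, with `∂ (log x) = 1 / x`. -/
def ddx (S : Type) [CommRing S] : Module.End S (LogSeries S) where
  toFun f := fun a k => ((a + 1 : ℤ) : S) * f (a + 1) k + f (a + 1) (k + 1)
  map_add' f g := by
    funext a k
    simp only [Pi.add_apply]
    ring
  map_smul' c f := by
    funext a k
    simp only [Pi.smul_apply, smul_eq_mul, RingHom.id_apply]
    ring

/-- Multiplication by `x`. -/
def mulX (S : Type) [CommRing S] : Module.End S (LogSeries S) where
  toFun f := fun a k => f (a - 1) k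
  map_add' _ _ := rfl
  map_smul' _ _ := rfl

/-- The operator
`D_K = (x∂ - l_1)⋯(x∂ - l_n) + ∑_{0 ≤ j ≤ m, 0 ≤ i < K} t_{i,j} x^i ∂^j`, in which the infinite
sum over `i` is cut at `K`. -/
def opD {n : ℕ} (l : Fin n → ℤ) (m : ℕ) (S : Type) [CommRing S] [Algebra RHat S] (K : ℕ) :
    Module.End S (LogSeries S) :=
  (List.ofFn fun s : Fin n => mulX S * ddx S - (l s : Module.End S (LogSeries S))).prod +
    ∑ j ∈ Finset.range (m + 1), ∑ i ∈ Finset.range K,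
      algebraMap RHat S (t i j) • (mulX S ^ i * ddx S ^ j)

/-- `D f = 0`: for each monomial `x ^ a * (log x) ^ k`, the infinite sum over `i` that gives its
coefficient in `D f` converges to `0` in the `I`-adic topology. -/
def IsSolution {n : ℕ} (l : Fin n → ℤ) (m : ℕ) {S : Type} [CommRing S] [Algebra RHat S]
    (f : LogSeries S) : Prop :=
  ∀ (a : ℤ) (k N : ℕ), ∃ K₀ : ℕ, ∀ K : ℕ, K₀ ≤ K → opD l m S K f a k ∈ filtIn S N

/-- The formal expression `x ^ δ * ∑_a r a * x ^ a`, with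
`x ^ δ = exp (δ log x) = ∑_k δ ^ k * (log x) ^ k / k!`. -/
def powSeries {S : Type} [CommRing S] (δ : S) (r : ℤ → S) : LogSeries S :=
  fun a k => δ ^ k * r a

end PDet

end

/-! Modulo `I` the matrix `B(ε)` is lower triangular, and its diagonal entry `∏_s (ε + i - l_s)` is
an invertible power series in `ε` unless `i` lies in the finite set `T` of the values of `l`. So the
rows outside `T` can be solved. This gives columns `v τ` (`τ ∈ T`) that restrict to the identity on
`T`, decay `I`-adically to the left, and are mapped by `B` to columns supported on `T`, where they
form a finite matrix `E(ε)`, an infinite Schur complement (`exists_isReduction`). Decay, convergence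
and uniqueness all come from one estimate, `IsAlmostLower.mem_of_rows`. Up to high `I`-adic order
the truncated determinants are unit multiples of `det E`. Weierstrass preparation is continuous, so
their Weierstrass polynomials converge, and `det E = w * unit` (`exists_isReduction_entryPS`).

Existence. Put `y = adj(E)(1,…,1)` and `V = ∑ y_τ v_τ`. Then `E y` is a multiple of `w`, so `B V`
vanishes modulo `w`, and substituting `ε = ε_j` gives solutions; to substitute into a power series,
take its remainder modulo `w`. The coefficients at `T` of the `j`-th solution sum to `h(ε_j)`, where
`h` is the remainder of the sum of the entries of `adj(E)`. In a linear relation with coefficients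
`c_j`, the powers of `log x` give `∑_j c_j ε_j^k h(ε_j) = 0` for all `k`, hence `c_j w'(ε_j) h(ε_j)
= 0`. A Bezout identity `w a + h w' b = d` with `0 ≠ d ∈ RHat` (`exists_bezout`) turns this into
`c_j d = 0`. It is found by specializing to `∏ (x∂ - l_s) + t_{0,0}`, whose matrix is diagonal.
Finally `d` is a non-zero-divisor in `RBar`, because `RHat` is a domain and `RBar` arises by
successively adjoining roots of monic polynomials; it stays nonzero in `RBar / P` because `P` meets
`RHat` in `0`.

Converse. Modulo `I^N S` the exponent `δ` is nilpotent, so the whole reduction can be evaluated at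
`δ`. It shows that `g` is determined by its coefficients `r_τ`, `τ ∈ T`, and that `w(δ) r_τ ∈ I^N S`
for every `N` (`exponent_mul_mem`). Since `S` is separated (`eq_zero_of_forall_mem_filtIn`) and `g ≠
0`, `w(δ) = 0`, and `w` splits over the domain `S`. -/

namespace PDet

/-! ### Complete filtered rings -/

/-- A decreasing multiplicative filtration of a commutative ring by ideals. -/
structure IsFiltration {A : Type*} [CommRing A] (F : ℕ → Ideal A) : Prop where
  zero : F 0 = ⊤
  anti : Antitone F
  mul_mem : ∀ {i j : ℕ} {x y : A}, x ∈ F i → y ∈ F j → x * y ∈ F (i + j)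

/-- A filtration for which the ring is complete and separated. -/
structure IsCompleteFiltration {A : Type*} [CommRing A] (F : ℕ → Ideal A) : Prop
    extends IsFiltration F where
  separated : ∀ {x : A}, (∀ k, x ∈ F k) → x = 0
  complete : ∀ a : ℕ → A, (∀ k, ∃ N, ∀ i j, N ≤ i → N ≤ j → a i - a j ∈ F k) →
    ∃ x, ∀ k, ∃ N, ∀ i, N ≤ i → a i - x ∈ F k

section Filtration

variable {A : Type*} [CommRing A] {F : ℕ → Ideal A}

lemma IsFiltration.pow_le (hF : IsFiltration F) (k : ℕ) : F 1 ^ k ≤ F k := by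
  induction k with
  | zero => simp [hF.zero]
  | succ k ih =>
    rw [pow_succ]
    exact Ideal.mul_le.2 fun x hx y hy => hF.mul_mem (ih hx) hy

lemma IsCompleteFiltration.isUnit_one_sub (hF : IsCompleteFiltration F) {x : A} (hx : x ∈ F 1) :
    IsUnit (1 - x) := by
  have hpow : ∀ k, x ^ k ∈ F k := fun k => hF.toIsFiltration.pow_le k (Ideal.pow_mem_pow hx k)
  obtain ⟨y, hy⟩ := hF.complete (fun n => ∑ i ∈ Finset.range n, x ^ i) (by
    intro k
    have key : ∀ i, k ≤ i →
        (∑ i ∈ Finset.range i, x ^ i) - ∑ i ∈ Finset.range k, x ^ i ∈ F k := by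
      intro i hi
      rw [Finset.sum_range_sub_sum_range hi]
      exact Ideal.sum_mem _ fun j hj => hF.anti (Finset.mem_filter.1 hj).2 (hpow j)
    refine ⟨k, fun i j hi hj => ?_⟩
    simpa using Ideal.sub_mem _ (key i hi) (key j hj))
  refine IsUnit.of_mul_eq_one y ?_
  rw [← sub_eq_zero]
  refine hF.separated fun k => ?_
  obtain ⟨N, hN⟩ := hy k
  have h1 := Ideal.mul_mem_left _ (1 - x) (hN (max N k) (le_max_left _ _))
  have h2 : x ^ max N k ∈ F k := hF.anti (le_max_right _ _) (hpow _)
  have h3 := mul_neg_geom_sum x (max N k)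
  have : (1 - x) * y - 1 =
      -((1 - x) * (∑ i ∈ Finset.range (max N k), x ^ i - y)) - x ^ max N k := by
    rw [mul_sub, h3]; ring
  rw [this]
  exact Ideal.sub_mem _ (Ideal.neg_mem_iff _ |>.2 h1) h2

lemma IsCompleteFiltration.isUnit_of_sub_mem (hF : IsCompleteFiltration F) {u x : A}
    (hu : IsUnit u) (h : x - u ∈ F 1) : IsUnit x := by
  obtain ⟨u, rfl⟩ := hu
  have : x = u * (1 - (↑u⁻¹ * -(x - u))) := by
    rw [mul_sub, ← mul_assoc, Units.mul_inv]; ring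
  rw [this]
  exact u.isUnit.mul (hF.isUnit_one_sub (Ideal.mul_mem_left _ _ (neg_mem h)))

open PowerSeries in
/-- The filtration of the ring of power series by the ideals of power series with coefficients
in the members of a filtration of the ring of coefficients. -/
def psFilt (F : ℕ → Ideal A) (k : ℕ) : Ideal (PowerSeries A) where
  carrier := {f | ∀ i, coeff i f ∈ F k}
  add_mem' hf hg i := by simpa using (F k).add_mem (hf i) (hg i)
  zero_mem' i := by simp
  smul_mem' c f hf i := by
    rw [smul_eq_mul, coeff_mul]
    exact Ideal.sum_mem _ fun p _ => Ideal.mul_mem_left _ _ (hf _)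

lemma mem_psFilt {k : ℕ} {f : PowerSeries A} :
    f ∈ psFilt F k ↔ ∀ i, PowerSeries.coeff i f ∈ F k := Iff.rfl

lemma IsFiltration.psFilt (hF : IsFiltration F) : IsFiltration (psFilt F) where
  zero := by
    rw [eq_top_iff]
    intro f _ i
    simp [hF.zero]
  anti i j hij f hf k := hF.anti hij (hf k)
  mul_mem {i j f g} hf hg k := by
    rw [PowerSeries.coeff_mul]
    exact Ideal.sum_mem _ fun p _ => hF.mul_mem (hf _) (hg _)

lemma IsCompleteFiltration.psFilt (hF : IsCompleteFiltration F) :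
    IsCompleteFiltration (psFilt F) where
  toIsFiltration := hF.toIsFiltration.psFilt
  separated h := by
    ext i
    exact hF.separated fun k => h k i
  complete a ha := by
    have h (i : ℕ) := hF.complete (fun n => PowerSeries.coeff i (a n)) (by
      intro k
      obtain ⟨N, hN⟩ := ha k
      exact ⟨N, fun p q hp hq => by simpa using hN p q hp hq i⟩)
    choose x hx using h
    refine ⟨PowerSeries.mk x, fun k => ?_⟩
    obtain ⟨N, hN⟩ := ha k
    refine ⟨N, fun p hp i => ?_⟩
    obtain ⟨N', hN'⟩ := hx i k
    have h1 := hN p (max N N') hp (le_max_left _ _) i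
    have h2 := hN' (max N N') (le_max_right _ _)
    have := (F k).add_mem h1 h2
    simpa using this

/-! ### Weierstrass division -/

open Polynomial

lemma coe_mem_psFilt {k : ℕ} {p : A[X]} :
    (p : PowerSeries A) ∈ psFilt F k ↔ ∀ i, p.coeff i ∈ F k := by
  simp [mem_psFilt]

/-- Quantitative uniqueness of Weierstrass division. As `w ≡ X ^ n` modulo `F 1`, coefficient `i +
n` of `w q + r` is coefficient `i` of `q` plus an error one filtration step deeper than `q`. Using
it for all `K` in a separated ring gives true uniqueness. -/
lemma psFilt_of_distinguished (hF : IsFiltration F) {w : A[X]} (hw : w.IsDistinguishedAt (F 1))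
    {q : PowerSeries A} {r : A[X]} (hr : ∀ i, w.natDegree ≤ i → r.coeff i = 0) {K : ℕ}
    (h : (w : PowerSeries A) * q + r ∈ psFilt F K) :
    q ∈ psFilt F K ∧ (r : PowerSeries A) ∈ psFilt F K := by
  set n := w.natDegree with hn
  have hw' : ((w - X ^ n : A[X]) : PowerSeries A) ∈ psFilt F 1 := by
    rw [coe_mem_psFilt]
    intro i
    rcases lt_trichotomy i n with hi | hi | hi
    · simpa [coeff_X_pow, hi.ne] using hw.mem hi
    · subst hi
      simp [hn, hw.monic.coeff_natDegree]
    · simp [coeff_X_pow, hi.ne', coeff_eq_zero_of_natDegree_lt (hn ▸ hi)]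
  have key : ∀ k ≤ K, q ∈ psFilt F k := by
    intro k hk
    induction k with
    | zero => simp [hF.psFilt.zero]
    | succ k ih =>
      intro i
      have h1 := hF.anti hk (h (i + n))
      have h2 := hF.psFilt.mul_mem hw' (ih (by omega)) (i + n)
      have e : (w : PowerSeries A) * q = ((w - X ^ n : A[X]) : PowerSeries A) * q +
          PowerSeries.X ^ n * q := by
        rw [Polynomial.coe_sub, Polynomial.coe_pow, Polynomial.coe_X]; ring
      rw [e] at h1
      simp only [map_add, Polynomial.coeff_coe, hr (i + n) (by omega), add_zero,
        PowerSeries.coeff_X_pow_mul] at h1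
      rw [add_comm 1 k] at h2
      simpa using (F (k + 1)).sub_mem h1 h2
  have hq := key K le_rfl
  refine ⟨hq, ?_⟩
  simpa using (psFilt F K).sub_mem h (Ideal.mul_mem_left _ (w : PowerSeries A) hq)

/-- A power series which, modulo the first step of the filtration, is `X ^ n` times a unit. -/
def HasWeierstrassDegree (F : ℕ → Ideal A) (n : ℕ) (f : PowerSeries A) : Prop :=
  ∃ u, IsUnit u ∧ f - PowerSeries.X ^ n * u ∈ psFilt F 1

/-- The successive quotients `H.seq` change by elements of `F 1 ^ k ≤ F k`, so they converge for
`F`; `F k` need not be a power of `F 1`. -/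
lemma exists_weierstrass_division (hF : IsCompleteFiltration F) (hF1 : F 1 ≠ ⊤) {n : ℕ}
    {g : PowerSeries A} (hg : HasWeierstrassDegree F n g) (f : PowerSeries A) :
    ∃ (q : PowerSeries A) (r : A[X]), f = g * q + r ∧ ∀ i, n ≤ i → r.coeff i = 0 := by
  obtain ⟨u, hu, hgu⟩ := hg
  have hord : (g.map (Ideal.Quotient.mk (F 1))).order = n := by
    rw [PowerSeries.order_eq_nat]
    have hc : ∀ i, PowerSeries.coeff i (g.map (Ideal.Quotient.mk (F 1))) =
        PowerSeries.coeff i ((PowerSeries.X ^ n * u).map (Ideal.Quotient.mk (F 1))) := by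
      intro i
      rw [PowerSeries.coeff_map, PowerSeries.coeff_map, Ideal.Quotient.mk_eq_mk_iff_sub_mem]
      simpa using hgu i
    have : Nontrivial (A ⧸ F 1) := Ideal.Quotient.nontrivial_iff.2 hF1
    refine ⟨?_, fun i hi => ?_⟩
    · rw [hc, PowerSeries.coeff_map, PowerSeries.coeff_X_pow_mul' ]
      simp only [le_refl, if_true, Nat.sub_self, PowerSeries.coeff_zero_eq_constantCoeff_apply]
      exact ((PowerSeries.isUnit_constantCoeff u hu).map _).ne_zero
    · rw [hc, PowerSeries.coeff_map, PowerSeries.coeff_X_pow_mul', if_neg (by omega), map_zero]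
  have hnat : (g.map (Ideal.Quotient.mk (F 1))).order.toNat = n := by simp [hord]
  have H : g.IsWeierstrassDivisorAt (F 1) := by
    rw [PowerSeries.IsWeierstrassDivisorAt, hnat]
    refine hF.isUnit_of_sub_mem (PowerSeries.isUnit_constantCoeff u hu) ?_
    have := hgu n
    rwa [map_sub, PowerSeries.coeff_X_pow_mul', if_pos le_rfl, Nat.sub_self,
      PowerSeries.coeff_zero_eq_constantCoeff_apply] at this
  have hstep : ∀ k, H.seq f (k + 1) - H.seq f k ∈ psFilt F k := fun k i =>
    hF.toIsFiltration.pow_le k (H.coeff_seq_succ_sub_seq_mem f k i)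
  have hdiff : ∀ k i, k ≤ i → H.seq f i - H.seq f k ∈ psFilt F k := by
    intro k i hi
    induction i, hi using Nat.le_induction with
    | base => simp
    | succ i hi ih => simpa using add_mem (hF.psFilt.anti hi (hstep i)) ih
  obtain ⟨q, hq⟩ := hF.psFilt.complete (H.seq f) fun k => ⟨k, fun i j hi hj => by
    simpa using sub_mem (hdiff k i hi) (hdiff k j hj)⟩
  have hz : ∀ i, n ≤ i → PowerSeries.coeff i (f - g * q) = 0 := by
    intro i hi
    refine hF.separated fun k => ?_
    obtain ⟨N, hN⟩ := hq k
    have h1 := hF.anti (le_max_right N k) (hF.toIsFiltration.pow_le _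
      (H.coeff_seq_mem f (max N k) (i := i) (by rwa [hnat])))
    have h2 := Ideal.mul_mem_left _ g (hN (max N k) (le_max_left _ _)) i
    have := add_mem h1 h2
    rw [← map_add] at this
    convert this using 2
    ring
  refine ⟨q, (f - g * q).trunc n, ?_, fun i hi => ?_⟩
  · rw [← sub_eq_iff_eq_add']
    ext i
    rw [Polynomial.coeff_coe, PowerSeries.coeff_trunc]
    split_ifs with h
    · rfl
    · exact hz i (by omega)
  · rw [PowerSeries.coeff_trunc, if_neg (by omega)]

/-- Divide `X ^ n` by `g`. Modulo `F 1` this reads `X ^ n (1 - u q) = r` with `deg r < n`, so `r`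
vanishes and `u q` has constant term `1` there. Hence `q` is a unit and `X ^ n - r = g q` is
distinguished. -/
lemma exists_weierstrass_preparation (hF : IsCompleteFiltration F) (hF1 : F 1 ≠ ⊤) {n : ℕ}
    {g : PowerSeries A} (hg : HasWeierstrassDegree F n g) :
    ∃ (w : A[X]) (u : PowerSeries A), w.IsDistinguishedAt (F 1) ∧ w.natDegree = n ∧ IsUnit u ∧
      g = w * u := by
  have : Nontrivial A := by
    by_contra h
    rw [not_nontrivial_iff_subsingleton] at h
    exact hF1 (Subsingleton.elim _ _)
  obtain ⟨q, r, hqr, hr⟩ := exists_weierstrass_division hF hF1 hg (PowerSeries.X ^ n)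
  obtain ⟨u, hu, hgu⟩ := hg
  have e1 : PowerSeries.X ^ n * (1 - u * q) - (r : PowerSeries A) ∈ psFilt F 1 := by
    have : PowerSeries.X ^ n * (1 - u * q) - (r : PowerSeries A) = (g - PowerSeries.X ^ n * u) * q := by
      rw [mul_sub, mul_one, hqr]; ring
    rw [this]
    exact Ideal.mul_mem_right _ _ hgu
  have hr1 : ∀ i, r.coeff i ∈ F 1 := by
    intro i
    by_cases hi : n ≤ i
    · simp [hr i hi]
    · have := e1 i
      rw [map_sub, PowerSeries.coeff_X_pow_mul', if_neg hi, zero_sub, neg_mem_iff] at this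
      simpa using this
  have hq : IsUnit q := by
    rw [PowerSeries.isUnit_iff_constantCoeff]
    have := e1 n
    rw [map_sub, PowerSeries.coeff_X_pow_mul', if_pos le_rfl, Nat.sub_self, Polynomial.coeff_coe,
      hr n le_rfl, sub_zero, PowerSeries.coeff_zero_eq_constantCoeff_apply, map_sub, map_one,
      map_mul] at this
    have h2 := hF.isUnit_one_sub this
    rw [sub_sub_cancel] at h2
    exact isUnit_of_mul_isUnit_right h2
  have hdeg : r.degree < n := by
    rw [Polynomial.degree_lt_iff_coeff_zero]
    exact hr
  have hmonic : (X ^ n - r).Monic := monic_X_pow_sub (by simpa using hdeg)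
  have hnat : (X ^ n - r).natDegree = n := by
    refine natDegree_eq_of_degree_eq_some ?_
    rw [degree_sub_eq_left_of_degree_lt (by simpa using hdeg), degree_X_pow]
  refine ⟨X ^ n - r, ↑hq.unit⁻¹, ⟨⟨fun {i} hi => ?_⟩, hmonic⟩, hnat, Units.isUnit _, ?_⟩
  · rw [hnat] at hi
    simpa [coeff_X_pow, hi.ne] using hr1 i
  · have : ((X ^ n - r : A[X]) : PowerSeries A) = g * q := by
      rw [Polynomial.coe_sub, Polynomial.coe_pow, Polynomial.coe_X, hqr]; ring
    rw [this, mul_assoc, IsUnit.mul_val_inv, mul_one]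

/-- Continuity of the Weierstrass polynomial. Dividing by `u'` turns the difference into `w (u / u'
- 1) + (w - w')` with `deg (w - w') < deg w`, a Weierstrass division of something small. -/
lemma weierstrass_sub_mem (hF : IsFiltration F) {w w' : A[X]} {u u' : PowerSeries A}
    (hw : w.IsDistinguishedAt (F 1)) (hw' : w'.IsDistinguishedAt (F 1))
    (hdeg : w.natDegree = w'.natDegree) (hu' : IsUnit u') {K : ℕ}
    (h : (w : PowerSeries A) * u - w' * u' ∈ psFilt F K) (i : ℕ) :
    w.coeff i - w'.coeff i ∈ F K := by
  obtain ⟨u', rfl⟩ := hu'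
  have e : (w : PowerSeries A) * (u * ↑u'⁻¹ - 1) + ((w - w' : A[X]) : PowerSeries A) =
      (w * u - w' * u') * ↑u'⁻¹ := by
    rw [sub_mul, mul_assoc (w' : PowerSeries A), Units.mul_inv, Polynomial.coe_sub]; ring
  have := (psFilt_of_distinguished hF hw (q := u * ↑u'⁻¹ - 1) (r := w - w') (K := K) ?_ ?_).2
  · simpa using (coe_mem_psFilt.1 this) i
  · intro j hj
    rcases hj.eq_or_lt with hj | hj
    · have h1 := hw.monic.coeff_natDegree
      have h2 := hw'.monic.coeff_natDegree
      rw [← hdeg] at h2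
      rw [coeff_sub, ← hj, h1, h2, sub_self]
    · rw [coeff_sub, coeff_eq_zero_of_natDegree_lt hj,
        coeff_eq_zero_of_natDegree_lt (hdeg ▸ hj), sub_zero]
  · rw [e]
    exact Ideal.mul_mem_right _ _ h

end Filtration

end PDet

namespace PDet

/-! ### Almost lower triangular infinite matrices -/

/-- A matrix indexed by the integers that is lower triangular modulo the first step of a
filtration, has no entries more than `m` places above the diagonal, and whose diagonal entries
outside of `T` are invertible. -/
structure IsAlmostLower {B : Type*} [CommRing B] (F : ℕ → Ideal B) (b : ℤ → ℤ → B) (m : ℕ)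
    (T : Finset ℤ) : Prop where
  pos : 0 < m
  small : ∀ {i j : ℤ}, i < j → b i j ∈ F 1
  eq_zero : ∀ {i j : ℤ}, i + m < j → b i j = 0
  isUnit : ∀ {i : ℤ}, i ∉ T → IsUnit (b i i)

section Schur

variable {B : Type*} [CommRing B] {F : ℕ → Ideal B} {b : ℤ → ℤ → B} {m : ℕ} {T : Finset ℤ}

/-- The main estimate. Row `i` is solved for `z i` by its invertible diagonal entry. Terms with `j <
i` are already in `F (k + 1)` by induction upwards from `L₀`. Terms with `j > i` have a coefficient
in `F 1` and reach at most `m` places further, where `z j ∈ F k`. So each gain of one filtration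
step costs `m` indices. -/
lemma IsAlmostLower.mem_of_rows (hb : IsAlmostLower F b m T) (hF : IsFiltration F) {C : ℤ} {K : ℕ}
    {z : ℤ → B} {L₀ : ℤ} (hz : ∀ i < L₀, z i ∈ F K)
    (h : ∀ k ≤ K, ∀ i : ℤ, i + k * m < C → z i ∈ F k ∨
      i ∉ T ∧ ∃ L ≤ i, ∑ j ∈ Finset.Icc L (i + m), b i j * z j ∈ F k) :
    ∀ k ≤ K, ∀ i : ℤ, i + k * m < C → z i ∈ F k := by
  intro k
  induction k with
  | zero => intro _ i _; simp [hF.zero]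
  | succ k ih =>
    intro hk
    have main : ∀ (d : ℕ) (i : ℤ), i < L₀ + d → i + (k + 1 : ℕ) * m < C → z i ∈ F (k + 1) := by
      intro d
      induction d with
      | zero => intro i hi _; exact hF.anti hk (hz i (by simpa using hi))
      | succ d ihd =>
        intro i hi hiC
        rcases h (k + 1) hk i hiC with h1 | ⟨hiT, L, hL, h1⟩
        · exact h1
        have hmem : i ∈ Finset.Icc L (i + m) := by
          rw [Finset.mem_Icc]; omega
        rw [← Finset.add_sum_erase _ _ hmem] at h1
        have h2 : ∑ j ∈ (Finset.Icc L (i + m)).erase i, b i j * z j ∈ F (k + 1) := by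
          refine Ideal.sum_mem _ fun j hj => ?_
          rw [Finset.mem_erase, Finset.mem_Icc] at hj
          rcases lt_or_gt_of_ne hj.1 with hlt | hgt
          · refine Ideal.mul_mem_left _ _ (ihd j ?_ (by linarith))
            push_cast at hi
            omega
          · rw [add_comm k 1]
            refine hF.mul_mem (hb.small hgt) (ih (by omega) j ?_)
            push_cast at hiC
            linarith [hj.2.2]
        have h3 := (F (k + 1)).sub_mem h1 h2
        rw [add_sub_cancel_right] at h3
        obtain ⟨u, hu⟩ := hb.isUnit hiT
        rw [← hu] at h3
        simpa using Ideal.mul_mem_left _ (↑u⁻¹) h3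
    intro i hi
    exact main (i - L₀ + 1).toNat i (by omega) hi

lemma det_sub_mem {ι : Type*} [Fintype ι] [DecidableEq ι] (J : Ideal B) {P Q : Matrix ι ι B}
    (h : ∀ i j, P i j - Q i j ∈ J) : P.det - Q.det ∈ J := by
  rw [← Ideal.Quotient.mk_eq_mk_iff_sub_mem, RingHom.map_det, RingHom.map_det]
  congr 1
  ext i j
  simpa [Ideal.Quotient.mk_eq_mk_iff_sub_mem] using h i j

lemma det_sub_prod_mem (J : Ideal B) (hJ : ∀ i j : ℤ, i < j → b i j ∈ J) (U : Finset ℤ) :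
    (Matrix.of fun i j : U => b i j).det - ∏ i ∈ U, b i i ∈ J := by
  rw [← Ideal.Quotient.mk_eq_mk_iff_sub_mem, RingHom.map_det, Matrix.det_of_isLowerTriangular,
    map_prod, ← Finset.prod_coe_sort U]
  · rfl
  · intro i j hij
    exact Ideal.Quotient.eq_zero_iff_mem.2 (hJ i j hij)

/-- The columns `v τ`, `τ ∈ T`, form the identity matrix on `T`, are supported in the window
`[-M, N]` and are annihilated by the rows of the window outside of `T`. -/
structure IsWindowSolution (b : ℤ → ℤ → B) (T : Finset ℤ) (M N : ℕ) (v : T → ℤ → B) : Prop where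
  supp : ∀ τ i, i ∉ Finset.Icc (-(M : ℤ)) N → v τ i = 0
  ident : ∀ τ τ' : T, v τ τ' = if τ' = τ then 1 else 0
  rows : ∀ τ, ∀ i ∈ Finset.Icc (-(M : ℤ)) N, i ∉ T →
    ∑ j ∈ Finset.Icc (-(M : ℤ)) N, b i j * v τ j = 0

/-- Schur complement: the block `D` off `T` is triangular modulo `F 1` with unit diagonal, hence
invertible. Off `T` the solution is `-D⁻¹ Cm`, and the right-hand determinant is that of `Am - Bm
D⁻¹ Cm`. -/
lemma exists_isWindowSolution (hb : IsAlmostLower F b m T) (hF : IsCompleteFiltration F)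
    {M N : ℕ} (hT : T ⊆ Finset.Icc (-(M : ℤ)) N) :
    ∃ v, IsWindowSolution b T M N v ∧ ∃ c, IsUnit c ∧
      (Matrix.of fun i j : Finset.Icc (-(M : ℤ)) (N : ℤ) => b i j).det = c *
        (Matrix.of fun τ' τ : T => ∑ j ∈ Finset.Icc (-(M : ℤ)) N, b τ' j * v τ j).det := by
  set W := Finset.Icc (-(M : ℤ)) (N : ℤ) with hW
  let D : Matrix ↥(W \ T) ↥(W \ T) B := Matrix.of fun i j => b i j
  let Cm : Matrix ↥(W \ T) T B := Matrix.of fun i j => b i j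
  let Bm : Matrix T ↥(W \ T) B := Matrix.of fun i j => b i j
  let Am : Matrix T T B := Matrix.of fun i j => b i j
  have hD : IsUnit D.det := by
    refine hF.isUnit_of_sub_mem ?_ (det_sub_prod_mem (F 1) (fun i j hij => hb.small hij) (W \ T))
    exact IsUnit.prod_iff.2 fun i hi => hb.isUnit (Finset.mem_sdiff.1 hi).2
  let V : Matrix ↥(W \ T) T B := -(D⁻¹ * Cm)
  have hDV : D * V + Cm = 0 := by
    simp only [V, Matrix.mul_neg, ← Matrix.mul_assoc, Matrix.mul_nonsing_inv _ hD, Matrix.one_mul]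
    simp
  let v : T → ℤ → B := fun τ i =>
    if h : i ∈ T then (1 : Matrix T T B) ⟨i, h⟩ τ else
      if h' : i ∈ W \ T then V ⟨i, h'⟩ τ else 0
  have vT : ∀ τ τ' : T, v τ τ' = (1 : Matrix T T B) τ' τ := fun τ τ' => by simp [v]
  have vW : ∀ τ (i : ↥(W \ T)), v τ i = V i τ := fun τ i => by
    have h1 := i.2
    simp only [v]
    rw [dif_neg (Finset.mem_sdiff.1 h1).2, dif_pos h1]
  have hsum : ∀ (f : ℤ → B) τ, ∑ j ∈ W, f j * v τ j =
      (∑ j : ↥(W \ T), f j * V j τ) + f τ := by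
    intro f τ
    rw [← Finset.sum_sdiff hT, ← Finset.sum_coe_sort (W \ T), ← Finset.sum_coe_sort T]
    congr 1
    · exact Finset.sum_congr rfl fun j _ => by rw [vW]
    · simp_rw [vT, Matrix.one_apply, mul_ite, mul_one, mul_zero]
      simp
  refine ⟨v, ⟨?_, ?_, ?_⟩, D.det, hD, ?_⟩
  · intro τ i hi
    have h1 : i ∉ T := fun h => hi (hT h)
    have h2 : i ∉ W \ T := fun h => hi (Finset.mem_sdiff.1 h).1
    simp only [v, dif_neg h1, dif_neg h2]
  · intro τ τ'
    rw [vT, Matrix.one_apply]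
  · intro τ i hi hiT
    rw [hsum]
    exact congrFun (congrFun hDV ⟨i, Finset.mem_sdiff.2 ⟨hi, hiT⟩⟩) τ
  · have hA : (Matrix.of fun τ' τ : T => ∑ j ∈ W, b τ' j * v τ j) = Am - Bm * D⁻¹ * Cm := by
      ext τ' τ
      rw [Matrix.of_apply, hsum, Matrix.mul_assoc, sub_eq_add_neg, add_comm, ← Matrix.mul_neg]
      rfl
    let s : T ⊕ ↥(W \ T) → W := Sum.elim (fun x => ⟨x, hT x.2⟩)
      (fun x => ⟨x, (Finset.mem_sdiff.1 x.2).1⟩)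
    have hs : Function.Bijective s := by
      constructor
      · rintro (x | x) (y | y) hxy
        · exact congrArg Sum.inl (Subtype.ext (congrArg (fun z : W => (z : ℤ)) hxy))
        · exact absurd ((congrArg Subtype.val hxy : (x : ℤ) = y) ▸ x.2) (Finset.mem_sdiff.1 y.2).2
        · exact absurd ((congrArg Subtype.val hxy : (x : ℤ) = y).symm ▸ y.2)
            (Finset.mem_sdiff.1 x.2).2
        · exact congrArg Sum.inr (Subtype.ext (congrArg (fun z : W => (z : ℤ)) hxy))
      · intro i
        by_cases h : (i : ℤ) ∈ T
        · exact ⟨Sum.inl ⟨i, h⟩, rfl⟩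
        · exact ⟨Sum.inr ⟨i, Finset.mem_sdiff.2 ⟨i.2, h⟩⟩, rfl⟩
    rw [← Matrix.det_submatrix_equiv_self (Equiv.ofBijective s hs)]
    have hblock : (Matrix.of fun i j : W => b i j).submatrix (Equiv.ofBijective s hs)
        (Equiv.ofBijective s hs) = Matrix.fromBlocks Am Bm Cm D := by
      ext (i | i) (j | j) <;> rfl
    let := Matrix.invertibleOfIsUnitDet D hD
    rw [hblock, Matrix.det_fromBlocks₂₂, hA, Matrix.invOf_eq_nonsing_inv]

lemma sum_window {M N : ℕ} (hb : IsAlmostLower F b m T) {v : ℤ → B}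
    (hv : ∀ i, i ∉ Finset.Icc (-(M : ℤ)) N → v i = 0) (i : ℤ) {L : ℤ} (hL : L ≤ -M) :
    ∑ j ∈ Finset.Icc L (i + m), b i j * v j = ∑ j ∈ Finset.Icc (-(M : ℤ)) N, b i j * v j := by
  trans ∑ j ∈ Finset.Icc L (max (i + m) N), b i j * v j
  · refine Finset.sum_subset (Finset.Icc_subset_Icc le_rfl (le_max_left _ _)) fun j hj hj' => ?_
    rw [Finset.mem_Icc] at hj hj'
    rw [hb.eq_zero (by omega), zero_mul]
  · refine (Finset.sum_subset (Finset.Icc_subset_Icc hL (le_max_right _ _)) fun j _ hj' => ?_).symm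
    rw [hv j hj', mul_zero]

lemma IsWindowSolution.row {M N : ℕ} (hb : IsAlmostLower F b m T) {v : T → ℤ → B}
    (hv : IsWindowSolution b T M N v) (τ : T) {i : ℤ} (hi : i ∈ Finset.Icc (-(M : ℤ)) N)
    (hiT : i ∉ T) {L : ℤ} (hL : L ≤ -M) :
    ∑ j ∈ Finset.Icc L (i + m), b i j * v τ j = 0 := by
  rw [sum_window hb (hv.supp τ) i hL, hv.rows τ i hi hiT]

/-- By `hC`, no `i ∈ T` satisfies `i + k * m < C` with `k ≥ 1`, so the estimate never needs the rows
of `T`. -/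
lemma IsWindowSolution.decay {M N : ℕ} (hb : IsAlmostLower F b m T) (hF : IsFiltration F)
    {v : T → ℤ → B} (hv : IsWindowSolution b T M N v) {C : ℤ} (hC : ∀ τ ∈ T, C ≤ τ + m)
    (τ : T) {k : ℕ} {i : ℤ} (hi : i + k * m < C) : v τ i ∈ F k := by
  refine hb.mem_of_rows hF (C := C) (K := k) (L₀ := -M) ?_ ?_ k le_rfl i hi
  · intro i hi
    rw [hv.supp τ i (by rw [Finset.mem_Icc]; omega)]
    exact zero_mem _
  · intro k _ i hi
    by_cases hW : i ∈ Finset.Icc (-(M : ℤ)) N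
    · by_cases hT : i ∈ T
      · left
        rcases Nat.eq_zero_or_pos k with rfl | hk
        · simp [hF.zero]
        · have := hC i hT
          have : (m : ℤ) ≤ k * m := by exact_mod_cast Nat.le_mul_of_pos_left m hk
          linarith
      · right
        refine ⟨hT, -M, (Finset.mem_Icc.1 hW).1, ?_⟩
        rw [hv.row hb τ hW hT le_rfl]
        exact zero_mem _
    · left
      rw [hv.supp τ i hW]
      exact zero_mem _

/-- Left of `-M` the smaller solution is zero and the larger one has decayed into `F K`. Inside the
window the difference vanishes on `T` and satisfies the other rows, so the error from the right end
fades `m` indices per filtration step. -/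
lemma IsWindowSolution.sub_mem_of_le {M N M' N' : ℕ} (hb : IsAlmostLower F b m T)
    (hF : IsFiltration F) {v v' : T → ℤ → B} (hv : IsWindowSolution b T M N v)
    (hv' : IsWindowSolution b T M' N' v') (hM : M ≤ M') (hN : N ≤ N') {C : ℤ}
    (hC : ∀ τ ∈ T, C ≤ τ + m) {K : ℕ} (hK : (K * m : ℤ) - C ≤ M) (τ : T) {i : ℤ}
    (hi : i + K * m < N + 1) : v' τ i - v τ i ∈ F K := by
  have hm : (0 : ℤ) < m := by exact_mod_cast hb.pos
  have hlow : ∀ i < -(M : ℤ), v' τ i - v τ i ∈ F K := by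
    intro i hi
    rw [hv.supp τ i (by rw [Finset.mem_Icc]; omega), sub_zero]
    exact hv'.decay hb hF hC τ (by linarith)
  refine hb.mem_of_rows hF (C := N + 1) (K := K) (z := fun i => v' τ i - v τ i) hlow ?_ K le_rfl
    i hi
  intro k hkK i hi
  rcases Nat.eq_zero_or_pos k with rfl | hk
  · left; simp [hF.zero]
  have hkm : (m : ℤ) ≤ k * m := by exact_mod_cast Nat.le_mul_of_pos_left m hk
  by_cases hiM : i < -(M : ℤ)
  · exact Or.inl (hF.anti hkK (hlow i hiM))
  have hW : i ∈ Finset.Icc (-(M : ℤ)) N := by rw [Finset.mem_Icc]; omega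
  have hW' : i ∈ Finset.Icc (-(M' : ℤ)) N' := by rw [Finset.mem_Icc] at hW ⊢; omega
  by_cases hT : i ∈ T
  · left
    have h1 := hv.ident τ ⟨i, hT⟩
    have h2 := hv'.ident τ ⟨i, hT⟩
    simp only at h1 h2
    rw [h1, h2, sub_self]
    exact zero_mem _
  · right
    refine ⟨hT, -M', by omega, ?_⟩
    simp_rw [mul_sub]
    rw [Finset.sum_sub_distrib, hv'.row hb τ hW' hT le_rfl, hv.row hb τ hW hT (by omega), sub_self]
    exact zero_mem _

lemma IsWindowSolution.sub_mem {M N M' N' : ℕ} (hb : IsAlmostLower F b m T)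
    (hF : IsCompleteFiltration F) {v v' : T → ℤ → B} (hv : IsWindowSolution b T M N v)
    (hv' : IsWindowSolution b T M' N' v') (hTW : T ⊆ Finset.Icc (-(M : ℤ)) N) {C : ℤ}
    (hC : ∀ τ ∈ T, C ≤ τ + m) {K : ℕ} (hK : (K * m : ℤ) - C ≤ M) (hK' : (K * m : ℤ) - C ≤ M')
    (τ : T) {i : ℤ} (hi : i + K * m < N + 1) (hi' : i + K * m < N' + 1) :
    v' τ i - v τ i ∈ F K := by
  obtain ⟨v'', hv'', -⟩ := exists_isWindowSolution hb hF (M := max M M') (N := max N N')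
    (hTW.trans (Finset.Icc_subset_Icc (by simp) (by simp)))
  have h1 := hv.sub_mem_of_le hb hF.toIsFiltration hv'' (le_max_left _ _) (le_max_left _ _) hC hK τ
    hi
  have h2 := hv'.sub_mem_of_le hb hF.toIsFiltration hv'' (le_max_right _ _) (le_max_right _ _) hC
    hK' τ hi'
  simpa using (F K).sub_mem h1 h2

/-- `v` consists of columns that are the identity matrix on `T`, decay to the left, and are mapped
by the infinite matrix `b` to columns supported on `T`, where they form the matrix `E`. -/
structure IsReduction (F : ℕ → Ideal B) (b : ℤ → ℤ → B) (m : ℕ) (T : Finset ℤ) (C : ℤ)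
    (v : T → ℤ → B) (E : Matrix T T B) : Prop where
  ident : ∀ τ τ' : T, v τ τ' = if τ' = τ then 1 else 0
  decay : ∀ (τ : T) (k : ℕ) (i : ℤ), i + k * m < C → v τ i ∈ F k
  rows : ∀ (K : ℕ) (i : ℤ) (τ : T), ∃ L₀, ∀ L ≤ L₀,
    ∑ j ∈ Finset.Icc L (i + m), b i j * v τ j - (if h : i ∈ T then E ⟨i, h⟩ τ else 0) ∈ F K

/-- Solutions on growing windows are entrywise Cauchy; `v` and `E` are the limits of the solutions
and of their Schur complements. -/
theorem exists_isReduction (hb : IsAlmostLower F b m T) (hF : IsCompleteFiltration F) {C : ℤ}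
    (hC : ∀ τ ∈ T, C ≤ τ + m) :
    ∃ v E, IsReduction F b m T C v E ∧ ∀ K, ∃ N₀ : ℕ, ∀ M N : ℕ, N₀ ≤ M → N₀ ≤ N → ∃ c, IsUnit c ∧
      (Matrix.of fun i j : Finset.Icc (-(M : ℤ)) (N : ℤ) => b i j).det - c * E.det ∈ F K := by
  obtain ⟨M₀, hM₀⟩ : ∃ M₀ : ℕ, ∀ τ ∈ T, |τ| ≤ M₀ := by
    refine ⟨∑ τ ∈ T, τ.natAbs, fun τ hτ => ?_⟩
    rw [Int.abs_eq_natAbs]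
    exact_mod_cast Finset.single_le_sum (f := Int.natAbs) (fun _ _ => Nat.zero_le _) hτ
  have hTW : ∀ {M N : ℕ}, M₀ ≤ M → M₀ ≤ N → T ⊆ Finset.Icc (-(M : ℤ)) N := by
    intro M N hM hN τ hτ
    have := abs_le.1 (hM₀ τ hτ)
    rw [Finset.mem_Icc]; omega
  have hex : ∀ n : ℕ, ∃ v, IsWindowSolution b T (M₀ + n) (M₀ + n) v := fun n =>
    (exists_isWindowSolution hb hF (hTW (by omega) (by omega))).imp fun _ h => h.1
  choose V hV using hex
  have hcauchy : ∀ τ i k, ∃ N, ∀ p q, N ≤ p → N ≤ q → V p τ i - V q τ i ∈ F k := by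
    intro τ i k
    refine ⟨(i + k * m).toNat + (k * m - C).toNat, fun p q hp hq => ?_⟩
    exact (hV q).sub_mem hb hF (hV p) (hTW (by omega) (by omega)) hC (by push_cast; omega)
      (by push_cast; omega) τ (by push_cast; omega) (by push_cast; omega)
  choose v hv using fun τ i => hF.complete (fun n => V n τ i) (hcauchy τ i)
  have hlim : ∀ {M N : ℕ} {u : T → ℤ → B}, IsWindowSolution b T M N u → M₀ ≤ M → M₀ ≤ N →
      ∀ {K : ℕ}, (K * m : ℤ) - C ≤ M → ∀ τ {i : ℤ}, i + K * m < N + 1 → u τ i - v τ i ∈ F K := by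
    intro M N u hu hM hN K hK τ i hi
    obtain ⟨N₁, hN₁⟩ := hv τ i K
    set p := max N₁ (max M N)
    have h1 := hN₁ p (le_max_left _ _)
    have h2 : M ≤ p := (le_max_left _ _).trans (le_max_right _ _)
    have h3 : N ≤ p := (le_max_right _ _).trans (le_max_right _ _)
    have h4 := (hV p).sub_mem hb hF hu (hTW (by omega) (by omega)) hC (by push_cast; omega) hK
      τ (by push_cast; omega) hi
    simpa using (F K).add_mem h4 h1
  let e : ∀ (M N : ℕ) (u : T → ℤ → B), T → T → B := fun M N u τ' τ =>
    ∑ j ∈ Finset.Icc (-(M : ℤ)) N, b τ' j * u τ j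
  have hrow : ∀ {M N : ℕ} {u : T → ℤ → B}, IsWindowSolution b T M N u → M₀ ≤ M → M₀ ≤ N →
      ∀ {K : ℕ}, (K * m : ℤ) - C ≤ M → ∀ τ {i : ℤ}, i + m + K * m < N + 1 → ∀ {L : ℤ}, L ≤ -M →
      ∑ j ∈ Finset.Icc L (i + m), b i j * v τ j - ∑ j ∈ Finset.Icc (-(M : ℤ)) N, b i j * u τ j ∈
        F K := by
    intro M N u hu hM hN K hK τ i hi L hL
    rw [← sum_window hb (hu.supp τ) i hL, ← Finset.sum_sub_distrib]
    refine Ideal.sum_mem _ fun j hj => ?_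
    rw [← mul_sub]
    refine Ideal.mul_mem_left _ _ ?_
    rw [← neg_mem_iff, neg_sub]
    exact hlim hu hM hN hK τ (by linarith [(Finset.mem_Icc.1 hj).2])
  have hecauchy : ∀ τ' τ k, ∃ N, ∀ p q, N ≤ p → N ≤ q →
      e (M₀ + p) (M₀ + p) (V p) τ' τ - e (M₀ + q) (M₀ + q) (V q) τ' τ ∈ F k := by
    intro τ' τ k
    refine ⟨((τ' : ℤ) + m + k * m).toNat + (k * m - C).toNat, fun p q hp hq => ?_⟩
    have h1 := hrow (hV p) (by omega) (by omega) (K := k) (by push_cast; omega) τ (i := τ')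
      (by push_cast; omega) (L := -(M₀ + p + q : ℕ)) (by push_cast; omega)
    have h2 := hrow (hV q) (by omega) (by omega) (K := k) (by push_cast; omega) τ (i := τ')
      (by push_cast; omega) (L := -(M₀ + p + q : ℕ)) (by push_cast; omega)
    have := (F k).sub_mem h2 h1
    rwa [sub_sub_sub_cancel_left] at this
  choose E hE using fun τ' τ => hF.complete (fun n => e (M₀ + n) (M₀ + n) (V n) τ' τ)
    (hecauchy τ' τ)
  have helim : ∀ {M N : ℕ} {u : T → ℤ → B}, IsWindowSolution b T M N u → M₀ ≤ M → M₀ ≤ N →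
      ∀ {K : ℕ}, (K * m : ℤ) - C ≤ M → ∀ τ' τ : T, (τ' : ℤ) + m + K * m < N + 1 →
      e M N u τ' τ - E τ' τ ∈ F K := by
    intro M N u hu hM hN K hK τ' τ hi
    obtain ⟨N₁, hN₁⟩ := hE τ' τ K
    set p := max N₁ (max M N)
    have h1 := hN₁ p (le_max_left _ _)
    have h2 : M ≤ p := (le_max_left _ _).trans (le_max_right _ _)
    have h3 : N ≤ p := (le_max_right _ _).trans (le_max_right _ _)
    have h4 := hrow hu hM hN hK τ hi (L := -(M₀ + p : ℕ)) (by push_cast; omega)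
    have h5 := hrow (hV p) (by omega) (by omega) (K := K) (by push_cast; omega) τ (i := τ')
      (by push_cast; omega) (L := -(M₀ + p : ℕ)) le_rfl
    have := (F K).add_mem ((F K).sub_mem h5 h4) h1
    simpa [e] using this
  refine ⟨v, Matrix.of E, ⟨?_, ?_, ?_⟩, ?_⟩
  · intro τ τ'
    refine sub_eq_zero.1 (hF.separated fun k => ?_)
    obtain ⟨N, hN⟩ := hv τ τ' k
    have := hN N le_rfl
    rw [(hV N).ident τ τ'] at this
    rwa [← neg_mem_iff, neg_sub]
  · intro τ k i hi
    obtain ⟨N, hN⟩ := hv τ i k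
    have h1 := (hV N).decay hb hF.toIsFiltration hC τ hi
    simpa using (F k).sub_mem h1 (hN N le_rfl)
  · intro K i τ
    set p := (i + m + K * m).toNat + (K * m - C).toNat + i.natAbs with hp
    refine ⟨-(M₀ + p : ℕ), fun L hL => ?_⟩
    have h1 := hrow (hV p) (by omega) (by omega) (K := K) (by push_cast; omega) τ (i := i)
      (by push_cast; omega) hL
    split_ifs with hi
    · have h2 := helim (hV p) (by omega) (by omega) (K := K) (by push_cast; omega) ⟨i, hi⟩ τ
        (by push_cast; omega)
      have := (F K).add_mem h1 h2
      simpa [e] using this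
    · rw [(hV p).rows τ i (by rw [Finset.mem_Icc]; push_cast; omega) hi] at h1
      exact h1
  · intro K
    -- On the left the window must reach the decay range `K * m - C`. On the right it must exceed
    -- `T` by the band width `m` plus `K * m` for the error from the right end.
    set N₀ := M₀ + (K * m - C).toNat + m + K * m with hN₀
    refine ⟨N₀, fun M N hM hN => ?_⟩
    obtain ⟨u, hu, c, hc, hdet⟩ := exists_isWindowSolution hb hF (hTW (M := M) (N := N)
      (by omega) (by omega))
    refine ⟨c, hc, ?_⟩
    rw [hdet, ← mul_sub]
    refine Ideal.mul_mem_left _ _ (det_sub_mem _ fun τ' τ => ?_)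
    refine helim hu (by omega) (by omega) (by omega) τ' τ ?_
    have h1 := abs_le.1 (hM₀ τ' τ'.2)
    have h2 : ((M₀ + (K * m - C).toNat + m + K * m : ℕ) : ℤ) ≤ N := by exact_mod_cast hN
    push_cast at h2
    omega

end Schur

end PDet

namespace PDet

/-! ### The completed coefficient ring -/

lemma algebraMap_mem_filt {p : PolyRing} {k : ℕ} :
    algebraMap PolyRing RHat p ∈ filt k ↔ p ∈ smallIdeal ^ k := by
  rw [filt, RingHom.mem_ker]
  change AdicCompletion.evalₐ smallIdeal k (algebraMap PolyRing RHat p) = 0 ↔ _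
  rw [AlgHom.commutes, Ideal.Quotient.algebraMap_eq, Ideal.Quotient.eq_zero_iff_mem]

lemma exists_forall_sub_algebraMap_mem_filt (x : RHat) :
    ∃ p : ℕ → PolyRing, (∀ k, x - algebraMap PolyRing RHat (p k) ∈ filt k) ∧
      ∀ i j, i ≤ j → p i - p j ∈ smallIdeal ^ i := by
  obtain ⟨a, rfl⟩ := AdicCompletion.mk_surjective _ _ x
  refine ⟨a, fun k => ?_, fun i j hij => ?_⟩
  · rw [filt, RingHom.mem_ker]
    change AdicCompletion.evalₐ smallIdeal k (_ - algebraMap PolyRing RHat (a k)) = 0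
    rw [map_sub, AlgHom.commutes, AdicCompletion.evalₐ_mk, Ideal.Quotient.algebraMap_eq]
    exact sub_self _
  · have := a.2 hij
    rwa [SModEq.sub_mem, smul_eq_mul, Ideal.mul_top] at this

lemma exists_rHat_of_cauchy (p : ℕ → PolyRing)
    (hp : ∀ i j, i ≤ j → p i - p j ∈ smallIdeal ^ i) :
    ∃ x : RHat, ∀ k, x - algebraMap PolyRing RHat (p k) ∈ filt k := by
  let a : AdicCompletion.AdicCauchySequence smallIdeal PolyRing := ⟨p, fun {i j} hij => by
    rw [SModEq.sub_mem, smul_eq_mul, Ideal.mul_top]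
    exact hp i j hij⟩
  refine ⟨AdicCompletion.mk _ _ a, fun k => ?_⟩
  rw [filt, RingHom.mem_ker]
  change AdicCompletion.evalₐ smallIdeal k (_ - algebraMap PolyRing RHat (p k)) = 0
  rw [map_sub, AlgHom.commutes, AdicCompletion.evalₐ_mk, Ideal.Quotient.algebraMap_eq]
  exact sub_self _

lemma filt_antitone : Antitone filt := by
  intro i j hij x hx
  obtain ⟨p, hp, hpp⟩ := exists_forall_sub_algebraMap_mem_filt x
  have h1 : p j ∈ smallIdeal ^ j := by
    rw [← algebraMap_mem_filt]
    simpa using (filt j).sub_mem hx (hp j)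
  have h2 : p i ∈ smallIdeal ^ i := by
    simpa using add_mem (hpp i j hij) (Ideal.pow_le_pow_right hij h1)
  simpa using add_mem (hp i) (algebraMap_mem_filt.2 h2)

theorem isCompleteFiltration_filt : IsCompleteFiltration filt where
  zero := by
    rw [eq_top_iff]
    intro x _
    obtain ⟨p, hp, -⟩ := exists_forall_sub_algebraMap_mem_filt x
    have : algebraMap PolyRing RHat (p 0) ∈ filt 0 := algebraMap_mem_filt.2 (by simp)
    simpa using add_mem (hp 0) this
  anti := filt_antitone
  mul_mem {i j x y} hx hy := by
    obtain ⟨p, hp, -⟩ := exists_forall_sub_algebraMap_mem_filt x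
    obtain ⟨q, hq, -⟩ := exists_forall_sub_algebraMap_mem_filt y
    have h1 : p (i + j) ∈ smallIdeal ^ i := by
      rw [← algebraMap_mem_filt]
      simpa using (filt i).sub_mem hx (filt_antitone (Nat.le_add_right i j) (hp (i + j)))
    have h2 : q (i + j) ∈ smallIdeal ^ j := by
      rw [← algebraMap_mem_filt]
      simpa using (filt j).sub_mem hy (filt_antitone (Nat.le_add_left j i) (hq (i + j)))
    have h3 : algebraMap PolyRing RHat (p (i + j) * q (i + j)) ∈ filt (i + j) := by
      rw [algebraMap_mem_filt, pow_add]
      exact Ideal.mul_mem_mul h1 h2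
    have h4 := add_mem (add_mem (Ideal.mul_mem_right y _ (hp (i + j)))
      (Ideal.mul_mem_left _ (algebraMap PolyRing RHat (p (i + j))) (hq (i + j)))) h3
    rw [map_mul] at h4
    convert h4 using 1
    ring
  separated {x} hx := AdicCompletion.ext_evalₐ fun k => by
    rw [map_zero]
    exact hx k
  complete a ha := by
    choose N hN using ha
    -- Partial sums give one index that is late enough for every precision up to `k`, so the
    -- diagonal approximations are Cauchy.
    let N' : ℕ → ℕ := fun k => ∑ i ∈ Finset.range (k + 1), N i
    have hN' : ∀ i j, i ≤ j → N i ≤ N' j := fun i j hij =>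
      Finset.single_le_sum (f := N) (fun _ _ => Nat.zero_le _) (Finset.mem_range.2 (by omega))
    choose q hq using fun k => exists_forall_sub_algebraMap_mem_filt (a (N' k))
    have hcauchy : ∀ i j, i ≤ j → q i i - q j j ∈ smallIdeal ^ i := by
      intro i j hij
      rw [← algebraMap_mem_filt, map_sub]
      have h1 := (hq i).1 i
      have h2 := filt_antitone hij ((hq j).1 j)
      have h3 := hN i (N' i) (N' j) (hN' i i le_rfl) (hN' i j hij)
      convert (filt i).sub_mem (add_mem h3 h2) h1 using 1
      ring
    obtain ⟨x, hx⟩ := exists_rHat_of_cauchy (fun k => q k k) hcauchy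
    refine ⟨x, fun k => ⟨N k, fun i hi => ?_⟩⟩
    have h1 := (hq k).1 k
    have h2 := hN k i (N' k) hi (hN' k k le_rfl)
    convert (filt k).sub_mem (add_mem h1 h2) (hx k) using 1
    ring

lemma smallIdeal_le_ker : smallIdeal ≤ RingHom.ker (MvPolynomial.constantCoeff (σ := ℕ × ℕ)
    (R := ℚ)) := by
  refine Ideal.span_le.2 ?_
  rintro _ ⟨i, j, -, rfl⟩
  simp

lemma filt_one_ne_top : filt 1 ≠ ⊤ := by
  rw [Ideal.ne_top_iff_one]
  intro h
  rw [← map_one (algebraMap PolyRing RHat), algebraMap_mem_filt, pow_one] at h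
  simpa using smallIdeal_le_ker h

lemma isUnit_intCast_rHat {z : ℤ} (hz : z ≠ 0) : IsUnit (z : RHat) := by
  have h1 : IsUnit (z : ℚ) := by simpa using hz
  have h2 := (h1.map (algebraMap ℚ PolyRing)).map (algebraMap PolyRing RHat)
  simpa using h2

lemma t_mem_filt {i j : ℕ} (h : i ≤ j) : t i j ∈ filt 1 := by
  rw [t, algebraMap_mem_filt, pow_one]
  exact Ideal.subset_span ⟨i, j, h, rfl⟩

/-! ### The regularized determinant -/

open Polynomial

variable {n : ℕ} (l : Fin n → ℤ) (m : ℕ)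

/-- The indices `i` for which the diagonal entry `b_{ii}` degenerates. -/
def resonances : Finset ℤ := Finset.univ.image l

/-- The matrix `B(ε)` with entries regarded as power series in `ε`. -/
noncomputable def entryPS (i j : ℤ) : PowerSeries RHat := (entry l m i j : RHat[X])

lemma entry_sub_mem {i j : ℤ} (h : i ≤ j) :
    ((entry l m i j : RHat[X]) : PowerSeries RHat) -
      ((if i = j then ∏ s : Fin n, (X + C ((j - l s : ℤ) : RHat)) else 0 : RHat[X]) :
        PowerSeries RHat) ∈ psFilt filt 1 := by
  rw [← Polynomial.coe_sub, coe_mem_psFilt, entry, add_sub_cancel_left]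
  intro c
  rw [finsetSum_coeff]
  refine Ideal.sum_mem _ fun k _ => ?_
  split_ifs with h0
  · rw [coeff_C_mul]
    exact Ideal.mul_mem_right _ _ (t_mem_filt (by omega))
  · simp

lemma constantCoeff_prod_X_add (i : ℤ) :
    PowerSeries.constantCoeff ((∏ s : Fin n, (X + C ((i - l s : ℤ) : RHat)) : RHat[X]) :
      PowerSeries RHat) = ((∏ s : Fin n, (i - l s) : ℤ) : RHat) := by
  rw [Polynomial.constantCoeff_coe, Polynomial.coeff_zero_prod]
  simp

/-- An entry on or above the diagonal involves only `t_{i,k}` with `i ≤ k`, which lie in `I`, apart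
from the Euler product. The width `max m 1` keeps the band positive for `m = 0`. -/
lemma isAlmostLower_entryPS :
    IsAlmostLower (psFilt filt) (entryPS l m) (max m 1) (resonances l) where
  pos := by simp
  small {i j} hij := by
    have := entry_sub_mem l m hij.le
    rwa [if_neg hij.ne, Polynomial.coe_zero, sub_zero] at this
  eq_zero {i j} hij := by
    have hij' : i + m < j := by
      have : (m : ℤ) ≤ ((max m 1 : ℕ) : ℤ) := by exact_mod_cast le_max_left m 1
      omega
    rw [entryPS, entry, if_neg (by omega), Finset.sum_eq_zero, add_zero, Polynomial.coe_zero]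
    intro k hk
    rw [if_neg]
    rw [Finset.mem_range] at hk
    omega
  isUnit {i} hi := by
    have h := entry_sub_mem l m (le_refl i)
    refine isCompleteFiltration_filt.psFilt.isUnit_of_sub_mem ?_ h
    rw [if_pos rfl, PowerSeries.isUnit_iff_constantCoeff, constantCoeff_prod_X_add]
    refine isUnit_intCast_rHat (Finset.prod_ne_zero_iff.2 fun s _ h0 => hi ?_)
    rw [sub_eq_zero.1 h0]
    exact Finset.mem_image_of_mem _ (Finset.mem_univ s)

lemma coe_truncDet (M N : ℕ) : ((truncDet l m M N : RHat[X]) : PowerSeries RHat) =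
    (Matrix.of fun i j : Finset.Icc (-(M : ℤ)) (N : ℤ) => entryPS l m i j).det := by
  rw [truncDet, ← Polynomial.coeToPowerSeries.ringHom_apply, RingHom.map_det]
  rfl

/-- Modulo `I` the determinant is `∏_s ∏_{j ∈ W} (ε + j - l_s)`. Each `s` contributes exactly one
factor `ε`, at `j = l_s`; the other factors have nonzero integers as constant terms, which are units
over `ℚ`. -/
lemma hasWeierstrassDegree_truncDet {M N : ℕ}
    (h : resonances l ⊆ Finset.Icc (-(M : ℤ)) N) :
    HasWeierstrassDegree filt n (truncDet l m M N : PowerSeries RHat) := by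
  set W := Finset.Icc (-(M : ℤ)) (N : ℤ)
  let P : RHat[X] := ∏ s : Fin n, ∏ j ∈ W.erase (l s), (X + C ((j - l s : ℤ) : RHat))
  have hl : ∀ s, l s ∈ W := fun s => h (Finset.mem_image_of_mem _ (Finset.mem_univ s))
  have hP : ∏ j ∈ W, ∏ s : Fin n, (X + C ((j - l s : ℤ) : RHat)) = X ^ n * P := by
    rw [Finset.prod_comm]
    have : ∀ s : Fin n, ∏ j ∈ W, (X + C ((j - l s : ℤ) : RHat)) =
        X * ∏ j ∈ W.erase (l s), (X + C ((j - l s : ℤ) : RHat)) := by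
      intro s
      rw [← Finset.mul_prod_erase _ _ (hl s)]
      simp
    simp_rw [this, Finset.prod_mul_distrib]
    simp [P]
  refine ⟨(P : PowerSeries RHat), ?_, ?_⟩
  · rw [PowerSeries.isUnit_iff_constantCoeff, Polynomial.constantCoeff_coe]
    simp_rw [P, Polynomial.coeff_zero_prod]
    refine IsUnit.prod_iff.2 fun s _ => IsUnit.prod_iff.2 fun j hj => ?_
    rw [coeff_add, coeff_X_zero, zero_add, coeff_C_zero]
    exact isUnit_intCast_rHat (sub_ne_zero.2 (Finset.mem_erase.1 hj).1)
  · have h1 := det_sub_prod_mem (psFilt filt 1)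
      (fun i j hij => (isAlmostLower_entryPS l m).small hij) W
    have h2 : ∏ i ∈ W, entryPS l m i i - PowerSeries.X ^ n * (P : PowerSeries RHat) ∈
        psFilt filt 1 := by
      have e : PowerSeries.X ^ n * (P : PowerSeries RHat) =
          ∏ j ∈ W, ((∏ s : Fin n, (X + C ((j - l s : ℤ) : RHat)) : RHat[X]) :
            PowerSeries RHat) := by
        simp_rw [← Polynomial.coeToPowerSeries.ringHom_apply]
        rw [← map_prod, hP, map_mul, map_pow]
        simp
      rw [e, ← Ideal.Quotient.mk_eq_mk_iff_sub_mem, map_prod, map_prod]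
      refine Finset.prod_congr rfl fun i _ => ?_
      rw [Ideal.Quotient.mk_eq_mk_iff_sub_mem]
      have := entry_sub_mem l m (le_refl i)
      rwa [if_pos rfl] at this
    rw [coe_truncDet]
    simpa using add_mem h1 h2

/-- Frees the definition from its choice: the degree is the order of `q` modulo `I`, and the
polynomial is then unique by `weierstrass_sub_mem` at every `K`. -/
lemma weierstrassPoly_eq {q p : RHat[X]} {u : PowerSeries RHat}
    (hp : p.IsDistinguishedAt (filt 1)) (hu : IsUnit u) (h : (q : PowerSeries RHat) = p * u) :
    weierstrassPoly q = p := by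
  have hex : ∃ p : RHat[X], ∃ u : PowerSeries RHat,
      PowerSeries.IsWeierstrassFactorizationAt (q : PowerSeries RHat) p u (filt 1) :=
    ⟨p, u, hp, hu, h⟩
  have hc : ∀ {v : PowerSeries RHat}, IsUnit v → PowerSeries.constantCoeff v ∉ filt 1 :=
    fun hv hm => filt_one_ne_top (Ideal.eq_top_of_isUnit_mem _ hm (PowerSeries.isUnit_constantCoeff _ hv))
  rw [weierstrassPoly, dif_pos hex]
  obtain ⟨u', hp', hu', h'⟩ := hex.choose_spec
  have d1 := hp.coe_natDegree_eq_order_map _ _ (hc hu) h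
  have d2 := hp'.coe_natDegree_eq_order_map _ _ (hc hu') h'
  have hd : hex.choose.natDegree = p.natDegree := by
    rw [← d1] at d2
    exact_mod_cast d2
  refine Polynomial.ext fun i => ?_
  refine sub_eq_zero.1 (isCompleteFiltration_filt.separated fun K => ?_)
  refine weierstrass_sub_mem isCompleteFiltration_filt.toIsFiltration (u := u') hp' hp hd hu ?_ i
  rw [← h, ← h', sub_self]
  exact zero_mem _

theorem exists_isReduction_entryPS :
    ∃ C v E u, IsReduction (psFilt filt) (entryPS l m) (max m 1) (resonances l) C v E ∧
      (w l m).IsDistinguishedAt (filt 1) ∧ (w l m).natDegree = n ∧ IsUnit u ∧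
      E.det = (w l m : PowerSeries RHat) * u := by
  obtain ⟨C, hC⟩ : ∃ C : ℤ, ∀ τ ∈ resonances l, C ≤ τ + (max m 1 : ℕ) := by
    obtain ⟨C, hC⟩ := (resonances l).bddBelow
    exact ⟨C, fun τ hτ => by have := hC hτ; omega⟩
  obtain ⟨B, hB⟩ : ∃ B : ℕ, resonances l ⊆ Finset.Icc (-(B : ℤ)) B := by
    obtain ⟨C₁, hC₁⟩ := (resonances l).bddBelow
    obtain ⟨C₂, hC₂⟩ := (resonances l).bddAbove
    refine ⟨C₁.natAbs + C₂.natAbs, fun τ hτ => ?_⟩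
    have h1 := hC₁ hτ
    have h2 := hC₂ hτ
    rw [Finset.mem_Icc]; omega
  have hF := isCompleteFiltration_filt
  obtain ⟨v, E, hvE, hdet⟩ := exists_isReduction (isAlmostLower_entryPS l m) hF.psFilt hC
  have hres : ∀ {M N : ℕ}, B ≤ M → B ≤ N → resonances l ⊆ Finset.Icc (-(M : ℤ)) N :=
    fun hM hN => hB.trans (Finset.Icc_subset_Icc (by omega) (by omega))
  have hE : HasWeierstrassDegree filt n E.det := by
    obtain ⟨N₀, hN₀⟩ := hdet 1
    obtain ⟨c, ⟨c, rfl⟩, hc'⟩ := hN₀ (max N₀ B) (max N₀ B) (le_max_left _ _) (le_max_left _ _)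
    rw [← coe_truncDet] at hc'
    obtain ⟨u, hu, hu'⟩ := hasWeierstrassDegree_truncDet l m
      (hres (le_max_right N₀ B) (le_max_right N₀ B))
    refine ⟨↑c⁻¹ * u, (Units.isUnit _).mul hu, ?_⟩
    have := Ideal.mul_mem_left _ (↑c⁻¹ : PowerSeries RHat) ((psFilt filt 1).sub_mem hu' hc')
    convert this using 1
    rw [sub_sub_sub_cancel_left, mul_sub, Units.inv_mul_cancel_left]
    ring
  obtain ⟨p, u, hp, hpn, hu, hpu⟩ := exists_weierstrass_preparation hF filt_one_ne_top hE
  have hreg : IsRegularizedDet l m p := by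
    intro K
    obtain ⟨N₀, hN₀⟩ := hdet K
    refine ⟨max N₀ B, fun M N hM hN i => ?_⟩
    rw [max_le_iff] at hM hN
    obtain ⟨c, hc, hc'⟩ := hN₀ M N hM.1 hN.1
    obtain ⟨p', u', hp', hpn', hu', hpu'⟩ := exists_weierstrass_preparation hF filt_one_ne_top
      (hasWeierstrassDegree_truncDet l m (hres hM.2 hN.2))
    rw [weierstrassPoly_eq hp' hu' hpu']
    refine weierstrass_sub_mem hF.toIsFiltration (u := u') hp' hp (hpn'.trans hpn.symm) (hc.mul hu) ?_ i
    rw [← coe_truncDet, hpu', hpu] at hc'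
    convert hc' using 1
    ring
  have hw : w l m = p := by
    have hex : ∃ p : RHat[X], IsRegularizedDet l m p := ⟨p, hreg⟩
    rw [w, dif_pos hex]
    refine Polynomial.ext fun i => ?_
    refine sub_eq_zero.1 (hF.separated fun K => ?_)
    obtain ⟨K₁, h1⟩ := hex.choose_spec K
    obtain ⟨K₂, h2⟩ := hreg K
    have := (filt K).sub_mem
      (h2 (max K₁ K₂) (max K₁ K₂) (le_max_right _ _) (le_max_right _ _) i)
      (h1 (max K₁ K₂) (max K₁ K₂) (le_max_left _ _) (le_max_left _ _) i)
    rwa [sub_sub_sub_cancel_left] at this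
  rw [hw]
  exact ⟨C, v, E, u, hvE, hp, hpn, hu, hpu⟩

end PDet

namespace PDet

/-! ### Homomorphisms from the completed coefficient ring -/

/-- The image of `x` is characterized by its polynomial approximations, so the ring identities can
be checked modulo each `G k`. -/
lemma exists_ringHom_rHat {S : Type*} [CommRing S] {G : ℕ → Ideal S}
    (hG : IsCompleteFiltration G) (g : PolyRing →+* S) (hg : smallIdeal ≤ (G 1).comap g) :
    ∃ φ : RHat →+* S, (∀ p, φ (algebraMap PolyRing RHat p) = g p) ∧
      ∀ k x, x ∈ filt k → φ x ∈ G k := by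
  have hF := isCompleteFiltration_filt
  have hpow : ∀ k p, p ∈ smallIdeal ^ k → g p ∈ G k := by
    intro k p hp
    have h1 : g p ∈ (smallIdeal ^ k).map g := Ideal.mem_map_of_mem g hp
    rw [Ideal.map_pow] at h1
    exact hG.toIsFiltration.pow_le k (Ideal.pow_right_mono (Ideal.map_le_iff_le_comap.2 hg) k h1)
  have hex : ∀ x : RHat, ∃ y : S, ∀ k p, x - algebraMap PolyRing RHat p ∈ filt k →
      y - g p ∈ G k := by
    intro x
    obtain ⟨p, hp, hpp⟩ := exists_forall_sub_algebraMap_mem_filt x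
    have hd : ∀ k i, k ≤ i → g (p k) - g (p i) ∈ G k := fun k i hi => by
      rw [← map_sub]
      exact hpow k _ (hpp k i hi)
    obtain ⟨y, hy⟩ := hG.complete (fun n => g (p n)) fun k => ⟨k, fun i j hi hj => by
      simpa using (G k).sub_mem (hd k j hj) (hd k i hi)⟩
    refine ⟨y, fun k q hq => ?_⟩
    obtain ⟨N, hN⟩ := hy k
    have h1 := hN (max N k) (le_max_left _ _)
    have h2 := hd k (max N k) (le_max_right _ _)
    have h3 : g (p k) - g q ∈ G k := by
      rw [← map_sub]
      refine hpow k _ (algebraMap_mem_filt.1 ?_)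
      rw [map_sub]
      simpa using (filt k).sub_mem hq (hp k)
    convert (G k).sub_mem h3 (add_mem h1 h2) using 1
    ring
  choose f hf using hex
  have huniq : ∀ x y, (∀ k p, x - algebraMap PolyRing RHat p ∈ filt k → y - g p ∈ G k) →
      f x = y := by
    intro x y hy
    obtain ⟨p, hp, -⟩ := exists_forall_sub_algebraMap_mem_filt x
    refine sub_eq_zero.1 (hG.separated fun k => ?_)
    simpa using (G k).sub_mem (hf x k _ (hp k)) (hy k _ (hp k))
  have halg : ∀ p, f (algebraMap PolyRing RHat p) = g p := by
    intro p
    refine huniq _ _ fun k q hq => ?_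
    rw [← map_sub] at hq ⊢
    exact hpow k _ (algebraMap_mem_filt.1 hq)
  have happrox : ∀ x k, ∃ p, x - algebraMap PolyRing RHat p ∈ filt k ∧ f x - g p ∈ G k := by
    intro x k
    obtain ⟨p, hp, -⟩ := exists_forall_sub_algebraMap_mem_filt x
    exact ⟨p k, hp k, hf x k _ (hp k)⟩
  refine ⟨{ toFun := f, map_one' := ?_, map_zero' := ?_, map_add' := ?_, map_mul' := ?_ },
    halg, ?_⟩
  · simpa using halg 1
  · intro x y
    refine sub_eq_zero.1 (hG.separated fun k => ?_)
    obtain ⟨p, hp, hp'⟩ := happrox x k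
    obtain ⟨q, hq, hq'⟩ := happrox y k
    have h := hf (x * y) k (p * q) (by
      rw [map_mul]
      convert add_mem (Ideal.mul_mem_right y _ hp)
        (Ideal.mul_mem_left _ (algebraMap PolyRing RHat p) hq) using 1
      ring)
    rw [map_mul] at h
    convert (G k).sub_mem h (add_mem (Ideal.mul_mem_right (f y) _ hp')
      (Ideal.mul_mem_left _ (g p) hq')) using 1
    ring
  · simpa using halg 0
  · intro x y
    refine sub_eq_zero.1 (hG.separated fun k => ?_)
    obtain ⟨p, hp, hp'⟩ := happrox x k
    obtain ⟨q, hq, hq'⟩ := happrox y k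
    have h := hf (x + y) k (p + q) (by
      rw [map_add]
      convert add_mem hp hq using 1
      ring)
    rw [map_add] at h
    convert (G k).sub_mem h (add_mem hp' hq') using 1
    ring
  · intro k x hx
    simpa using hf x k 0 (by simpa using hx)

/-! ### Weight filtrations of power series rings -/

/-- The ideal of the power series all of whose monomials have weight at least `k`. -/
def weightFilt {σ : Type*} (wt : σ → ℕ) (k : ℕ) : Ideal (MvPowerSeries σ ℚ) where
  carrier := {f | ∀ μ, Finsupp.weight wt μ < k → MvPowerSeries.coeff μ f = 0}
  add_mem' hf hg μ hμ := by rw [map_add, hf μ hμ, hg μ hμ, add_zero]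
  zero_mem' μ _ := map_zero _
  smul_mem' c f hf μ hμ := by
    classical
    rw [smul_eq_mul, MvPowerSeries.coeff_mul]
    refine Finset.sum_eq_zero fun p hp => ?_
    rw [Finset.HasAntidiagonal.mem_antidiagonal] at hp
    rw [hf p.2, mul_zero]
    rw [← hp, map_add] at hμ
    omega

lemma isCompleteFiltration_weightFilt {σ : Type*} (wt : σ → ℕ) :
    IsCompleteFiltration (weightFilt wt) where
  zero := by
    rw [eq_top_iff]
    intro f _ μ hμ
    omega
  anti i j hij f hf μ hμ := hf μ (by omega)
  mul_mem {i j f g} hf hg μ hμ := by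
    classical
    rw [MvPowerSeries.coeff_mul]
    refine Finset.sum_eq_zero fun p hp => ?_
    rw [Finset.HasAntidiagonal.mem_antidiagonal] at hp
    rw [← hp, map_add] at hμ
    rcases lt_or_ge (Finsupp.weight wt p.1) i with h | h
    · rw [hf _ h, zero_mul]
    · rw [hg _ (by omega), mul_zero]
  separated {f} hf := by
    ext μ
    simpa using hf (Finsupp.weight wt μ + 1) μ (by omega)
  complete a ha := by
    choose N hN using ha
    let x : MvPowerSeries σ ℚ := fun μ =>
      MvPowerSeries.coeff μ (a (N (Finsupp.weight wt μ + 1)))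
    have hx : ∀ μ, MvPowerSeries.coeff μ x =
      MvPowerSeries.coeff μ (a (N (Finsupp.weight wt μ + 1))) := fun μ => rfl
    refine ⟨x, fun k => ⟨N k, fun i hi μ hμ => ?_⟩⟩
    have h1 := hN k i (max (N k) (N (Finsupp.weight wt μ + 1))) hi (le_max_left _ _) μ hμ
    have h2 := hN (Finsupp.weight wt μ + 1) (N (Finsupp.weight wt μ + 1))
      (max (N k) (N (Finsupp.weight wt μ + 1))) le_rfl (le_max_right _ _) μ (by omega)
    rw [map_sub, sub_eq_zero] at h1 h2 ⊢
    rw [h1, hx, h2]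

lemma X_mem_weightFilt {σ : Type*} (wt : σ → ℕ) {s : σ} (hs : wt s = 1) :
    (MvPowerSeries.X s : MvPowerSeries σ ℚ) ∈ weightFilt wt 1 := by
  classical
  intro μ hμ
  rw [MvPowerSeries.coeff_X, if_neg]
  rintro rfl
  rw [Finsupp.weight_single] at hμ
  simp [hs] at hμ

/-- Under this specialization the operator becomes `∏ (x∂ - l_s) + t_{0,0}`, with diagonal matrix;
it serves to test that a resultant is nonzero. -/
theorem exists_specialization : ∃ (G : ℕ → Ideal (PowerSeries ℚ)) (φ : RHat →+* PowerSeries ℚ),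
    IsCompleteFiltration G ∧ (∀ k x, x ∈ filt k → φ x ∈ G k) ∧
      ∀ i j, φ (t i j) = if i = 0 ∧ j = 0 then PowerSeries.X else 0 := by
  let g : PolyRing →+* PowerSeries ℚ := (MvPolynomial.aeval (R := ℚ) fun s : ℕ × ℕ =>
    if s.1 = 0 ∧ s.2 = 0 then (PowerSeries.X : PowerSeries ℚ) else 0).toRingHom
  have hg : ∀ s, g (MvPolynomial.X s) = if s.1 = 0 ∧ s.2 = 0 then PowerSeries.X else 0 :=
    fun s => MvPolynomial.aeval_X _ _
  obtain ⟨φ, h1, h2⟩ := exists_ringHom_rHat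
    (isCompleteFiltration_weightFilt (σ := Unit) fun _ => 1) g (by
      refine Ideal.span_le.2 ?_
      rintro _ ⟨i, j, -, rfl⟩
      rw [SetLike.mem_coe, Ideal.mem_comap, hg]
      split_ifs
      · exact X_mem_weightFilt _ rfl
      · exact zero_mem _)
  refine ⟨_, φ, isCompleteFiltration_weightFilt (σ := Unit) fun _ => 1, h2, fun i j => ?_⟩
  rw [t, h1, hg]

lemma mem_smallIdeal_pow {k : ℕ} {p : PolyRing}
    (hp : ∀ μ ∈ p.support, k ≤ Finsupp.weight (fun s : ℕ × ℕ => if s.1 ≤ s.2 then 1 else 0) μ) :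
    p ∈ smallIdeal ^ k := by
  rw [p.as_sum]
  refine Ideal.sum_mem _ fun μ hμ => Ideal.pow_le_pow_right (hp μ hμ) ?_
  rw [MvPolynomial.monomial_eq]
  refine Ideal.mul_mem_left _ _ ?_
  rw [Finsupp.weight_apply, Finsupp.sum, ← Finset.prod_pow_eq_pow_sum, Finsupp.prod]
  refine Ideal.prod_mem_prod fun s _ => ?_
  rw [smul_eq_mul, mul_comm, pow_mul]
  refine Ideal.pow_mem_pow ?_ _
  split_ifs with h
  · rw [pow_one]
    exact Ideal.subset_span ⟨s.1, s.2, h, rfl⟩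
  · simp

/-- The completion embeds into the power series ring in all `t_{i,j}`. The weight counts the
variables with `i ≤ j`, and a polynomial whose monomials all have weight at least `k` lies in
`smallIdeal ^ k`, so the map has no kernel. -/
instance : IsDomain RHat := by
  let wt : ℕ × ℕ → ℕ := fun s => if s.1 ≤ s.2 then 1 else 0
  obtain ⟨φ, h1, h2⟩ := exists_ringHom_rHat (isCompleteFiltration_weightFilt wt)
    (MvPolynomial.coeToMvPowerSeries.ringHom (σ := ℕ × ℕ) (R := ℚ)) (by
      refine Ideal.span_le.2 ?_
      rintro _ ⟨i, j, h, rfl⟩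
      rw [SetLike.mem_coe, Ideal.mem_comap, MvPolynomial.coeToMvPowerSeries.ringHom_apply,
        MvPolynomial.coe_X]
      exact X_mem_weightFilt _ (if_pos h))
  have hinj : Function.Injective φ := by
    rw [injective_iff_map_eq_zero]
    intro x hx
    refine isCompleteFiltration_filt.separated fun k => ?_
    obtain ⟨p, hp, -⟩ := exists_forall_sub_algebraMap_mem_filt x
    have h3 := h2 k _ (hp k)
    rw [map_sub, hx, zero_sub, neg_mem_iff, h1] at h3
    have h4 : p k ∈ smallIdeal ^ k := by
      refine mem_smallIdeal_pow fun μ hμ => ?_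
      by_contra hlt
      have := h3 μ (not_le.1 hlt)
      rw [MvPolynomial.coeToMvPowerSeries.ringHom_apply, MvPolynomial.coeff_coe] at this
      exact MvPolynomial.mem_support_iff.1 hμ this
    simpa using add_mem (hp k) (algebraMap_mem_filt.2 h4)
  have : IsDomain (MvPowerSeries (ℕ × ℕ) ℚ) := NoZeroDivisors.to_isDomain _
  exact hinj.isDomain φ

end PDet

namespace PDet

open Polynomial

/-! ### Weierstrass division applied to polynomials -/

section

variable {A : Type*} [CommRing A] {F : ℕ → Ideal A}

lemma hasWeierstrassDegree_of_distinguished {w : A[X]} (hw : w.IsDistinguishedAt (F 1)) :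
    HasWeierstrassDegree F w.natDegree (w : PowerSeries A) := by
  refine ⟨1, isUnit_one, ?_⟩
  rw [mul_one, ← Polynomial.coe_X, ← Polynomial.coe_pow, ← Polynomial.coe_sub, coe_mem_psFilt]
  intro i
  rcases lt_trichotomy i w.natDegree with hi | hi | hi
  · simpa [coeff_X_pow, hi.ne] using hw.mem hi
  · simp [hi, hw.monic.coeff_natDegree]
  · simp [coeff_X_pow, hi.ne', coeff_eq_zero_of_natDegree_lt hi]

/-- Monic division of `p` by `w` is also a Weierstrass division, so by uniqueness the two remainders
agree. -/
lemma exists_polynomial_quotient (hF : IsCompleteFiltration F) {w : A[X]}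
    (hw : w.IsDistinguishedAt (F 1)) {p r : A[X]} {q : PowerSeries A}
    (hr : ∀ i, w.natDegree ≤ i → r.coeff i = 0) (h : (p : PowerSeries A) = w * q + r) :
    ∃ c, p = w * c + r := by
  nontriviality A
  have hp := modByMonic_add_div p w
  refine ⟨p /ₘ w, ?_⟩
  suffices r = p %ₘ w by rw [this, add_comm, hp]
  have hdeg : ∀ i, w.natDegree ≤ i → (p %ₘ w).coeff i = 0 := by
    rw [← degree_lt_iff_coeff_zero, ← degree_eq_natDegree hw.monic.ne_zero]
    exact degree_modByMonic_lt p hw.monic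
  refine Polynomial.ext fun i => sub_eq_zero.1 (hF.separated fun K => ?_)
  have := (psFilt_of_distinguished hF.toIsFiltration hw (K := K)
    (q := q - ((p /ₘ w : A[X]) : PowerSeries A)) (r := r - p %ₘ w) (fun i hi => by
      rw [coeff_sub, hr i hi, hdeg i hi, sub_zero]) ?_).2
  · simpa using coe_mem_psFilt.1 this i
  · have e : (w : PowerSeries A) * (q - ((p /ₘ w : A[X]) : PowerSeries A)) +
        ((r - p %ₘ w : A[X]) : PowerSeries A) = 0 := by
      have h1 : (p : PowerSeries A) = ((p %ₘ w : A[X]) : PowerSeries A) +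
          w * ((p /ₘ w : A[X]) : PowerSeries A) := by
        rw [← Polynomial.coe_mul, ← Polynomial.coe_add, hp]
      rw [Polynomial.coe_sub, mul_sub, ← add_sub_assoc, sub_add_eq_add_sub, ← h, h1]
      ring
    rw [e]
    exact zero_mem _

end

/-! ### Nonvanishing of a resultant -/

variable {n : ℕ} (l : Fin n → ℤ) (m : ℕ)

/-- The polynomial `(X + i - l_1) ⋯ (X + i - l_n)`. -/
noncomputable def shiftedProd (i : ℤ) : ℚ[X] := ∏ s : Fin n, (X + C ((i - l s : ℤ) : ℚ))

/-- The largest root is `max l - i`, which determines `i`. -/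
lemma shiftedProd_injective (hn : n ≠ 0) : Function.Injective (shiftedProd l) := by
  have key : ∀ i j, i < j → shiftedProd l i ≠ shiftedProd l j := by
    intro i j hij h
    have : Nonempty (Fin n) := Fin.pos_iff_nonempty.1 (Nat.pos_of_ne_zero hn)
    obtain ⟨s₀, hs₀⟩ := Finite.exists_max l
    have h1 : (shiftedProd l i).eval ((l s₀ - i : ℤ) : ℚ) = 0 := by
      rw [shiftedProd, eval_prod]
      refine Finset.prod_eq_zero (Finset.mem_univ s₀) ?_
      rw [eval_add, eval_X, eval_C]
      push_cast
      ring
    rw [h, shiftedProd, eval_prod, Finset.prod_eq_zero_iff] at h1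
    obtain ⟨s, -, hs⟩ := h1
    rw [eval_add, eval_X, eval_C] at hs
    have h2 : l s₀ - i + (j - l s) = 0 := by exact_mod_cast hs
    have := hs₀ s
    omega
  intro i j h
  rcases lt_trichotomy i j with hij | hij | hij
  · exact absurd h (key i j hij)
  · exact hij
  · exact absurd h.symm (key j i hij)

/-- Since `θ` is minus a polynomial value at `ξ`, `ξ` is transcendental too; hence distinct
polynomials differ at `ξ` and a nonzero derivative does not vanish there. -/
lemma no_common_root (hn : n ≠ 0) {Ω : Type*} [Field Ω] [Algebra ℚ Ω] {θ : Ω}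
    (hθ : Transcendental ℚ θ) {i : ℤ} {ξ : Ω} (h : aeval ξ (shiftedProd l i) + θ = 0) :
    (∀ j, j ≠ i → aeval ξ (shiftedProd l j) + θ ≠ 0) ∧
      aeval ξ (derivative (shiftedProd l i)) ≠ 0 := by
  have hξ : Transcendental ℚ ξ := by
    intro hξ
    apply hθ
    rw [eq_neg_of_add_eq_zero_right h]
    have h1 : IsIntegral ℚ (aeval ξ (shiftedProd l i)) := adjoin_le_integralClosure
      (isAlgebraic_iff_isIntegral.1 hξ) (aeval_mem_adjoin_singleton ℚ ξ)
    exact h1.isAlgebraic.neg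
  have hinj := transcendental_iff_injective.1 hξ
  constructor
  · intro j hj h'
    exact hj (shiftedProd_injective l hn (hinj (add_right_cancel (h'.trans h.symm))))
  · intro h'
    have h0 : derivative (shiftedProd l i) = 0 := hinj (h'.trans (map_zero _).symm)
    have h1 := derivative_eq_zero.1 h0
    rw [shiftedProd, natDegree_prod_of_monic _ _ fun _ _ => monic_X_add_C _] at h1
    simp_rw [natDegree_X_add_C] at h1
    simp [hn] at h1

lemma entry_map_specialization {φ : RHat →+* PowerSeries ℚ}
    (hφ : ∀ i j, φ (t i j) = if i = 0 ∧ j = 0 then PowerSeries.X else 0) (i j : ℤ) :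
    (entry l m i j).map φ = if i = j then
      (shiftedProd l i).map (algebraMap ℚ (PowerSeries ℚ)) + C PowerSeries.X else 0 := by
  rw [entry, Polynomial.map_add, Polynomial.map_sum]
  split_ifs with h
  · subst h
    congr 1
    · simp [shiftedProd, Polynomial.map_prod]
    · rw [Finset.sum_eq_single 0]
      · simp [hφ]
      · intro k _ hk
        have e : ((k : ℤ) + i - i).toNat = k := by omega
        rw [e, if_pos (by omega), Polynomial.map_mul, map_C, hφ, if_neg (by omega)]
        simp
      · intro h
        simp at h
  · rw [Polynomial.map_zero, zero_add]
    refine Finset.sum_eq_zero fun k _ => ?_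
    split_ifs with h0
    · rw [Polynomial.map_mul, map_C, hφ, if_neg (by omega)]
      simp
    · simp

/-- The specialized matrix is diagonal, so only the term `j = τ'` survives in row `τ'`, and there
`v` is the identity. -/
lemma isReduction_specialization {φ : RHat →+* PowerSeries ℚ} {G : ℕ → Ideal (PowerSeries ℚ)}
    (hG : IsCompleteFiltration G) (hφG : ∀ k x, x ∈ filt k → φ x ∈ G k)
    (hφ : ∀ i j, φ (t i j) = if i = 0 ∧ j = 0 then PowerSeries.X else 0)
    {C₀ : ℤ} {v : resonances l → ℤ → PowerSeries RHat}
    {E : Matrix (resonances l) (resonances l) (PowerSeries RHat)}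
    (hvE : IsReduction (psFilt filt) (entryPS l m) (max m 1) (resonances l) C₀ v E) :
    (PowerSeries.map φ).mapMatrix E = Matrix.diagonal fun τ : resonances l =>
      (((shiftedProd l τ).map (algebraMap ℚ (PowerSeries ℚ)) + C PowerSeries.X :
        (PowerSeries ℚ)[X]) : PowerSeries (PowerSeries ℚ)) := by
  ext1 τ' τ
  refine (sub_eq_zero.1 (hG.psFilt.separated fun K => ?_)).symm
  obtain ⟨L₀, hL₀⟩ := hvE.rows K τ' τ
  have h := hL₀ (min L₀ τ') (min_le_left _ _)
  rw [dif_pos τ'.2] at h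
  have h' : PowerSeries.map φ (∑ j ∈ Finset.Icc (min L₀ (τ' : ℤ)) (τ' + (max m 1 : ℕ)),
      entryPS l m τ' j * v τ j - E τ' τ) ∈ psFilt G K := fun i => by
    rw [PowerSeries.coeff_map]
    exact hφG K _ (h i)
  have hentry : ∀ j : ℤ, PowerSeries.map φ (entryPS l m τ' j) = if (τ' : ℤ) = j then
      (((shiftedProd l τ').map (algebraMap ℚ (PowerSeries ℚ)) + C PowerSeries.X :
        (PowerSeries ℚ)[X]) : PowerSeries (PowerSeries ℚ)) else 0 := by
    intro j
    rw [entryPS, ← Polynomial.polynomial_map_coe, entry_map_specialization l m hφ]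
    split_ifs <;> simp
  rw [map_sub, map_sum] at h'
  simp_rw [map_mul, hentry, ite_mul, zero_mul] at h'
  rw [Finset.sum_ite_eq, if_pos (by rw [Finset.mem_Icc]; omega), hvE.ident] at h'
  rw [Matrix.diagonal_apply]
  change _ - PowerSeries.map φ (E τ' τ) ∈ _
  convert h' using 2
  split_ifs with h1 <;> simp

/-- Take `d` to be the resultant of `w` and `h w'`. If it vanished, the specializations would have a
common root `ξ`. But `w` then divides `∏ Q τ`, and `no_common_root` makes `ξ` a simple root of
exactly one `Q τ`. -/
theorem exists_bezout {C₀ : ℤ} {v : resonances l → ℤ → PowerSeries RHat}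
    {E : Matrix (resonances l) (resonances l) (PowerSeries RHat)} {u : PowerSeries RHat}
    (hvE : IsReduction (psFilt filt) (entryPS l m) (max m 1) (resonances l) C₀ v E)
    (hw : (w l m).IsDistinguishedAt (filt 1)) (hwn : (w l m).natDegree = n)
    (hdet : E.det = (w l m : PowerSeries RHat) * u)
    {q : PowerSeries RHat} {h : RHat[X]} (hh : ∀ i, n ≤ i → h.coeff i = 0)
    (hs : ∑ τ, ∑ τ', E.adjugate τ τ' = (w l m : PowerSeries RHat) * q + h) :
    ∃ d : RHat, d ≠ 0 ∧ ∃ a b : RHat[X], w l m * a + h * derivative (w l m) * b = C d := by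
  rcases eq_or_ne n 0 with hn | hn
  · refine ⟨1, one_ne_zero, 1, 0, ?_⟩
    rw [eq_one_of_monic_natDegree_zero hw.monic (hwn.trans hn)]
    simp
  obtain ⟨G, φ, hG, hφG, hφ⟩ := exists_specialization
  let Ω := AlgebraicClosure (FractionRing (PowerSeries ℚ))
  let ι : PowerSeries ℚ →+* Ω := algebraMap _ _
  have hι : Function.Injective ι := by
    have : ι = (algebraMap (FractionRing (PowerSeries ℚ)) Ω).comp (algebraMap _ _) :=
      IsScalarTower.algebraMap_eq _ _ _
    rw [this, RingHom.coe_comp]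
    exact (algebraMap (FractionRing (PowerSeries ℚ)) Ω).injective.comp
      (IsFractionRing.injective _ _)
  have hθ : Transcendental ℚ (ι PowerSeries.X) := by
    rw [transcendental_iff]
    intro p hp
    have h1 : aeval (ι PowerSeries.X) p = ι (p : PowerSeries ℚ) := by
      have h2 : ∀ p : ℚ[X], (aeval (ι PowerSeries.X)).toRingHom p =
          (ι.comp Polynomial.coeToPowerSeries.ringHom) p := by
        intro p
        congr 1
        refine Polynomial.ringHom_ext' (RingHom.ext_rat _ _) ?_
        simp
      exact h2 p
    rw [h1] at hp
    exact Polynomial.coe_injective ℚ ((hι (hp.trans (map_zero ι).symm)).trans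
      Polynomial.coe_zero.symm)
  set g : RHat[X] := h * derivative (w l m) with hg
  refine ⟨resultant (w l m) g n g.natDegree, ?_, ?_⟩
  swap
  · obtain ⟨a, b, -, -, hab⟩ := exists_mul_add_mul_eq_C_resultant (w l m) g hwn.le le_rfl
      (Or.inl hn)
    exact ⟨a, b, hab⟩
  intro hres
  have hres' := congrArg (ι.comp φ) hres
  have hWn : ((w l m).map (ι.comp φ)).natDegree = n := by
    rw [hw.monic.natDegree_map, hwn]
  rw [map_zero, ← resultant_map_map] at hres'
  -- The degree of `g` may drop under specialization. As `w` stays monic, this changes the resultant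
  -- only by a power of `1`.
  obtain ⟨k, hk⟩ := Nat.exists_eq_add_of_le (natDegree_map_le (f := ι.comp φ) (p := g))
  rw [hk, resultant_add_right_deg _ _ _ _ _ le_rfl] at hres'
  have hcoeff : ((w l m).map (ι.comp φ)).coeff n = 1 := by
    have := (hw.monic.map (ι.comp φ)).coeff_natDegree
    rwa [hWn] at this
  rw [hcoeff, one_pow, one_mul] at hres'
  have hncop : ¬ IsCoprime ((w l m).map (ι.comp φ)) (g.map (ι.comp φ)) := by
    refine (resultant_eq_zero_iff.1 ?_).2
    rw [hWn]
    exact hres'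
  rw [isCoprime_iff_aeval_ne_zero_of_isAlgClosed Ω Ω] at hncop
  push Not at hncop
  obtain ⟨ξ, hξ1, hξ2⟩ := hncop
  let Q : resonances l → (PowerSeries ℚ)[X] := fun τ =>
    (shiftedProd l τ).map (algebraMap ℚ (PowerSeries ℚ)) + C PowerSeries.X
  have hE : (PowerSeries.map φ).mapMatrix E = Matrix.diagonal fun τ => (Q τ : PowerSeries _) :=
    isReduction_specialization l m hG hφG hφ hvE
  set w₀ := (w l m).map φ with hw₀
  have hw₀n : w₀.natDegree = n := by rw [hw₀, hw.monic.natDegree_map, hwn]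
  have hw₀d : w₀.IsDistinguishedAt (G 1) := by
    refine ⟨⟨fun {i} hi => ?_⟩, hw.monic.map _⟩
    rw [hw₀, coeff_map]
    exact hφG 1 _ (hw.mem (by rwa [hwn, ← hw₀n]))
  obtain ⟨c₁, hc₁⟩ := exists_polynomial_quotient hG hw₀d (p := ∏ τ, Q τ) (r := 0)
    (q := PowerSeries.map φ u) (fun i _ => coeff_zero i) (by
      have := congrArg (PowerSeries.map φ) hdet
      rw [RingHom.map_det, hE, Matrix.det_diagonal, map_mul,
        ← Polynomial.polynomial_map_coe] at this
      rw [Polynomial.coe_zero, add_zero, ← this]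
      simp_rw [← Polynomial.coeToPowerSeries.ringHom_apply, map_prod])
  obtain ⟨c₂, hc₂⟩ := exists_polynomial_quotient hG hw₀d
    (p := ∑ τ, ∏ τ' ∈ Finset.univ.erase τ, Q τ') (r := h.map φ)
    (q := PowerSeries.map φ q) (fun i hi => by rw [coeff_map, hh i (hw₀n ▸ hi), map_zero]) (by
      have := congrArg (PowerSeries.map φ) hs
      have h1 : ∀ τ τ', PowerSeries.map φ (E.adjugate τ τ') =
          ((PowerSeries.map φ).mapMatrix E.adjugate) τ τ' := fun _ _ => rfl
      simp_rw [map_sum, h1, RingHom.map_adjugate, hE, Matrix.adjugate_diagonal,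
        Matrix.diagonal_apply] at this
      rw [map_add, map_mul, ← Polynomial.polynomial_map_coe, ← Polynomial.polynomial_map_coe]
        at this
      rw [← this]
      simp only [Finset.sum_ite_eq, Finset.mem_univ, if_true]
      simp_rw [← Polynomial.coeToPowerSeries.ringHom_apply, map_sum, map_prod])
  have hQ : ∀ τ : resonances l, eval₂ ι ξ (Q τ) =
      aeval ξ (shiftedProd l τ) + ι PowerSeries.X := by
    intro τ
    rw [eval₂_add, eval₂_C, eval₂_map, aeval_def]
    congr 2
  have hdQ : ∀ τ : resonances l, eval₂ ι ξ (derivative (Q τ)) =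
      aeval ξ (derivative (shiftedProd l τ)) := by
    intro τ
    rw [derivative_add, derivative_C, add_zero, derivative_map, eval₂_map, aeval_def]
    congr 1
  have hξ1' : eval₂ ι ξ w₀ = 0 := by
    rw [hw₀, eval₂_map]
    simpa [aeval_def, eval₂_map] using hξ1
  have hprod := congrArg (eval₂ ι ξ) hc₁
  rw [add_zero, eval₂_mul, hξ1', zero_mul, eval₂_finsetProd, Finset.prod_eq_zero_iff] at hprod
  obtain ⟨τ, -, hτ⟩ := hprod
  rw [hQ] at hτ
  obtain ⟨hτ1, hτ2⟩ := no_common_root l hn hθ hτ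
  have herase : ∏ τ' ∈ Finset.univ.erase τ, eval₂ ι ξ (Q τ') ≠ 0 := by
    refine Finset.prod_ne_zero_iff.2 fun τ' hτ' => ?_
    rw [hQ]
    exact hτ1 τ' fun e => (Finset.mem_erase.1 hτ').1 (Subtype.ext e)
  have hother : ∀ τ'', τ'' ≠ τ → ∏ τ' ∈ Finset.univ.erase τ'', eval₂ ι ξ (Q τ') = 0 := by
    intro τ'' hne
    exact Finset.prod_eq_zero (Finset.mem_erase.2 ⟨hne.symm, Finset.mem_univ τ⟩) (by rw [hQ, hτ])
  have hg' : eval₂ ι ξ (h.map φ) * eval₂ ι ξ (derivative w₀) = 0 := by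
    rw [← eval₂_mul, hw₀, derivative_map, ← Polynomial.map_mul, eval₂_map]
    rw [aeval_def, eval₂_map, Algebra.algebraMap_self, RingHom.id_comp] at hξ2
    exact hξ2
  -- At `ξ` only the `τ` summand survives: `h` takes the value `∏_{τ' ≠ τ} Q τ'`, and the derivative
  -- of `∏ Q` is this product times the derivative of `Q τ`. Both are nonzero.
  rcases mul_eq_zero.1 hg' with h0 | h0
  · have := congrArg (eval₂ ι ξ) hc₂
    rw [eval₂_add, eval₂_mul, hξ1', h0, zero_mul, add_zero, eval₂_finsetSum] at this
    simp_rw [eval₂_finsetProd] at this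
    rw [Finset.sum_eq_single τ (fun τ'' _ hne => hother τ'' hne) (by simp)] at this
    exact herase this
  · have := congrArg (fun p => eval₂ ι ξ (derivative p)) hc₁
    simp only [add_zero, derivative_prod_finset, derivative_mul, eval₂_add, eval₂_mul, hξ1', h0, zero_mul,
      eval₂_finsetSum, eval₂_finsetProd] at this
    rw [Finset.sum_eq_single τ (fun τ'' _ hne => by rw [hother τ'' hne, zero_mul]) (by simp),
      hdQ] at this
    exact mul_ne_zero herase hτ2 this

end PDet

namespace PDet

open Polynomial

/-! ### The universal splitting ring -/

/-- The ideal of relations `f = ∏_j (X - x_j)` in the polynomial ring in the `x_j`. -/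
noncomputable def relationIdeal {A : Type} [CommRing A] (f : A[X]) (n : ℕ) : Ideal (MvPolynomial (Fin n) A) :=
  Ideal.span (Set.range fun k : ℕ => (f.map (MvPolynomial.C : A →+* MvPolynomial (Fin n) A) -
    ∏ j : Fin n, (X - C (MvPolynomial.X j))).coeff k)

lemma relationIdeal_le_ker_iff {A B : Type} [CommRing A] [CommRing B] {f : A[X]} {n : ℕ}
    (ψ : MvPolynomial (Fin n) A →+* B) : relationIdeal f n ≤ RingHom.ker ψ ↔
      f.map (ψ.comp MvPolynomial.C) = ∏ j : Fin n, (X - C (ψ (MvPolynomial.X j))) := by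
  have h : f.map (ψ.comp MvPolynomial.C) - ∏ j : Fin n, (X - C (ψ (MvPolynomial.X j))) =
      (f.map (MvPolynomial.C : A →+* MvPolynomial (Fin n) A) -
        ∏ j : Fin n, (X - C (MvPolynomial.X j))).map ψ := by
    simp [Polynomial.map_map, Polynomial.map_prod]
  rw [← sub_eq_zero, h, Polynomial.ext_iff, relationIdeal, Ideal.span_le, Set.range_subset_iff]
  simp [RingHom.mem_ker]

lemma map_mk_relationIdeal {A : Type} [CommRing A] (f : A[X]) (n : ℕ) :
    f.map ((Ideal.Quotient.mk (relationIdeal f n)).comp MvPolynomial.C) =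
      ∏ j : Fin n, (X - C (Ideal.Quotient.mk (relationIdeal f n) (MvPolynomial.X j))) :=
  (relationIdeal_le_ker_iff _).1 (Ideal.mk_ker).ge

lemma adjoinRoot_of_regular {A : Type} [CommRing A] {f : A[X]} (hf : f.Monic) {d : A}
    (hd : ∀ x, d * x = 0 → x = 0) (y : AdjoinRoot f) (hy : AdjoinRoot.of f d * y = 0) : y = 0 := by
  rcases subsingleton_or_nontrivial A with _ | _
  · exact (Module.subsingleton A (AdjoinRoot f)).elim _ _
  have h : d • y = 0 := by rwa [Algebra.smul_def, AdjoinRoot.algebraMap_eq]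
  refine (AdjoinRoot.powerBasis' hf).basis.ext_elem fun i => ?_
  have h1 := congrArg (fun z => (AdjoinRoot.powerBasis' hf).basis.repr z i) h
  simp only [map_smul, map_zero, Finsupp.smul_apply, Finsupp.zero_apply, smul_eq_mul] at h1
  rw [hd _ h1, map_zero, Finsupp.zero_apply]

/-- Splitting off one root identifies the first variable with the root in `AdjoinRoot f`, which is
free over `A`, and leaves a quotient `f₁` of degree `n`; regularity of `d` passes up this tower.
Instead of an isomorphism it suffices that `φ` maps `I` into `J`, that `ψ` kills `J`, and that `ψ ∘
φ` is the quotient map. -/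
theorem mem_relationIdeal_of_C_mul_mem (n : ℕ) : ∀ {A : Type} [CommRing A] {f : A[X]},
    f.Monic → f.natDegree = n → ∀ {d : A}, (∀ x, d * x = 0 → x = 0) →
    ∀ p : MvPolynomial (Fin n) A, MvPolynomial.C d * p ∈ relationIdeal f n →
      p ∈ relationIdeal f n := by
  induction n with
  | zero =>
    intro A _ f hf hfn d hd p hp
    have h0 : relationIdeal f 0 = ⊥ := by
      rw [eq_one_of_monic_natDegree_zero hf hfn, relationIdeal, Ideal.span_eq_bot]
      rintro _ ⟨k, rfl⟩
      simp
    rw [h0, Ideal.mem_bot] at hp ⊢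
    ext μ
    have := congrArg (MvPolynomial.coeff μ) hp
    rw [MvPolynomial.coeff_C_mul, MvPolynomial.coeff_zero] at this
    rw [hd _ this, MvPolynomial.coeff_zero]
  | succ n ih =>
    intro A _ f hf hfn d hd p hp
    have : Nontrivial A := by
      by_contra h
      rw [not_nontrivial_iff_subsingleton] at h
      rw [natDegree_of_subsingleton] at hfn
      omega
    set I := relationIdeal f (n + 1)
    obtain ⟨f₁, hf₁⟩ : (X - C (AdjoinRoot.root f)) ∣ f.map (AdjoinRoot.of f) := by
      rw [dvd_iff_isRoot]
      exact AdjoinRoot.isRoot_root f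
    have hA : Nontrivial (AdjoinRoot f) := Ideal.Quotient.nontrivial_iff.2 (by
      rw [Ne, Ideal.span_singleton_eq_top, hf.isUnit_iff, ← hf.natDegree_eq_zero, hfn]
      exact n.succ_ne_zero)
    have hf₁m : f₁.Monic := (monic_X_sub_C _).of_mul_monic_left (hf₁ ▸ hf.map _)
    have hf₁n : f₁.natDegree = n := by
      have := congrArg natDegree hf₁
      rw [hf.natDegree_map, hfn, (monic_X_sub_C _).natDegree_mul hf₁m, natDegree_X_sub_C] at this
      omega
    let φ : MvPolynomial (Fin (n + 1)) A →+* MvPolynomial (Fin n) (AdjoinRoot f) :=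
      MvPolynomial.eval₂Hom (MvPolynomial.C.comp (AdjoinRoot.of f))
        (Fin.cons (MvPolynomial.C (AdjoinRoot.root f)) MvPolynomial.X)
    have hφC : ∀ a, φ (MvPolynomial.C a) = MvPolynomial.C (AdjoinRoot.of f a) := fun a =>
      MvPolynomial.eval₂Hom_C _ _ _
    have hφ0 : φ (MvPolynomial.X 0) = MvPolynomial.C (AdjoinRoot.root f) :=
      MvPolynomial.eval₂Hom_X' _ _ _
    have hφs : ∀ i : Fin n, φ (MvPolynomial.X i.succ) = MvPolynomial.X i := fun i =>
      MvPolynomial.eval₂Hom_X' _ _ _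
    let J := relationIdeal f₁ n
    have hφI : ∀ q ∈ I, φ q ∈ J := by
      have hker : I ≤ RingHom.ker ((Ideal.Quotient.mk J).comp φ) := by
        rw [relationIdeal_le_ker_iff, Fin.prod_univ_succ]
        simp only [RingHom.comp_apply, hφ0, hφs]
        rw [← map_mk_relationIdeal f₁ n]
        have hc : (((Ideal.Quotient.mk J).comp φ).comp MvPolynomial.C) =
            ((Ideal.Quotient.mk J).comp MvPolynomial.C).comp (AdjoinRoot.of f) :=
          RingHom.ext fun a => by simp only [RingHom.comp_apply, hφC]
        rw [hc, ← Polynomial.map_map, hf₁, Polynomial.map_mul]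
        simp [J]
      intro q hq
      exact Ideal.Quotient.eq_zero_iff_mem.1 (hker hq)
    have hsplit := map_mk_relationIdeal f (n + 1)
    rw [Fin.prod_univ_succ] at hsplit
    have hroot : f.eval₂ ((Ideal.Quotient.mk I).comp MvPolynomial.C)
        (Ideal.Quotient.mk I (MvPolynomial.X 0)) = 0 := by
      rw [← eval_map, hsplit, eval_mul]
      simp [I]
    let α : AdjoinRoot f →+* MvPolynomial (Fin (n + 1)) A ⧸ I :=
      AdjoinRoot.lift ((Ideal.Quotient.mk I).comp MvPolynomial.C)
        (Ideal.Quotient.mk I (MvPolynomial.X 0)) hroot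
    let ψ : MvPolynomial (Fin n) (AdjoinRoot f) →+* MvPolynomial (Fin (n + 1)) A ⧸ I :=
      MvPolynomial.eval₂Hom α fun i => Ideal.Quotient.mk I (MvPolynomial.X i.succ)
    have hψJ : J ≤ RingHom.ker ψ := by
      rw [relationIdeal_le_ker_iff]
      have hc : ψ.comp MvPolynomial.C = α := RingHom.ext fun a => MvPolynomial.eval₂Hom_C _ _ _
      have hX : ∀ i, ψ (MvPolynomial.X i) = Ideal.Quotient.mk I (MvPolynomial.X i.succ) :=
        fun i => MvPolynomial.eval₂Hom_X' _ _ _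
      have h1 : f.map ((Ideal.Quotient.mk I).comp MvPolynomial.C) =
          (X - C (Ideal.Quotient.mk I (MvPolynomial.X 0))) * f₁.map α := by
        have h2 : (Ideal.Quotient.mk I).comp MvPolynomial.C = α.comp (AdjoinRoot.of f) :=
          RingHom.ext fun a => (AdjoinRoot.lift_of hroot).symm
        rw [h2, ← Polynomial.map_map, hf₁, Polynomial.map_mul]
        simp [α, AdjoinRoot.lift_root]
      rw [h1] at hsplit
      simp_rw [hc, hX]
      exact (monic_X_sub_C _).isRegular.left hsplit
    have hψφ : ψ.comp φ = Ideal.Quotient.mk I := by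
      refine MvPolynomial.ringHom_ext (fun a => ?_) fun i => ?_
      · rw [RingHom.comp_apply, hφC]
        exact (MvPolynomial.eval₂Hom_C _ _ _).trans (AdjoinRoot.lift_of hroot)
      · rw [RingHom.comp_apply]
        refine Fin.cases ?_ (fun i => ?_) i
        · rw [hφ0]
          exact (MvPolynomial.eval₂Hom_C _ _ _).trans (AdjoinRoot.lift_root hroot)
        · rw [hφs]
          exact MvPolynomial.eval₂Hom_X' _ _ _
    have h1 := hφI _ hp
    rw [map_mul, hφC] at h1
    have h2 := ih hf₁m hf₁n (adjoinRoot_of_regular hf hd) _ h1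
    rw [← Ideal.Quotient.eq_zero_iff_mem, ← hψφ]
    exact hψJ h2

variable {n : ℕ} (l : Fin n → ℤ) (m : ℕ)

lemma map_w_eq_prod : (w l m).map (algebraMap RHat (RBar l m)) =
    ∏ j : Fin n, (X - C (root l m j)) :=
  map_mk_relationIdeal (w l m) n

lemma aeval_root_w (j : Fin n) : aeval (root l m j) (w l m) = 0 := by
  rw [aeval_def, ← eval_map, map_w_eq_prod, eval_prod]
  exact Finset.prod_eq_zero (Finset.mem_univ j) (by simp)

lemma eq_zero_of_algebraMap_mul_eq_zero (hw : (w l m).Monic) (hn : (w l m).natDegree = n)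
    {d : RHat} (hd : d ≠ 0) {x : RBar l m} (hx : algebraMap RHat (RBar l m) d * x = 0) :
    x = 0 := by
  obtain ⟨p, rfl⟩ := Ideal.Quotient.mk_surjective x
  refine Ideal.Quotient.eq_zero_iff_mem.2 (mem_relationIdeal_of_C_mul_mem n hw hn (d := d)
    (fun y hy => (mul_eq_zero.1 hy).resolve_left hd) p ?_)
  exact Ideal.Quotient.eq_zero_iff_mem.1 hx

lemma finite_rBar (hw : (w l m).Monic) : Module.Finite RHat (RBar l m) := by
  have h1 : Algebra.FiniteType RHat (RBar l m) :=
    inferInstanceAs (Algebra.FiniteType RHat (MvPolynomial (Fin n) RHat ⧸ splitIdeal l m))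
  have h2 : Algebra.IsIntegral RHat (RBar l m) := by
    refine ⟨fun x => ?_⟩
    obtain ⟨p, rfl⟩ := Ideal.Quotient.mk_surjective x
    induction p using MvPolynomial.induction_on with
    | C a => exact isIntegral_algebraMap (R := RHat) (A := RBar l m) (x := a)
    | add p q hp hq =>
      rw [map_add]
      exact IsIntegral.add (R := RHat) (A := RBar l m) hp hq
    | mul_X p j hp =>
      rw [map_mul]
      exact IsIntegral.mul (R := RHat) (A := RBar l m) hp ⟨w l m, hw, aeval_root_w l m j⟩
  exact Algebra.IsIntegral.finite

end PDet

namespace PDet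

/-! ### The operator on formal expressions `x ^ δ * ∑_a r a * x ^ a` -/

section

variable {S : Type} [CommRing S] (δ : S) (r : ℤ → S)

lemma ddx_powSeries : ddx S (powSeries δ r) =
    powSeries δ fun a => (δ + ((a + 1 : ℤ) : S)) * r (a + 1) := by
  funext a k
  change ((a + 1 : ℤ) : S) * (δ ^ k * r (a + 1)) + δ ^ (k + 1) * r (a + 1) =
    δ ^ k * ((δ + ((a + 1 : ℤ) : S)) * r (a + 1))
  ring

lemma mulX_powSeries : mulX S (powSeries δ r) = powSeries δ fun a => r (a - 1) := rfl

lemma mulX_pow_powSeries (i : ℕ) :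
    (mulX S ^ i) (powSeries δ r) = powSeries δ fun a => r (a - i) := by
  induction i with
  | zero => simp
  | succ i ih =>
    rw [pow_succ', Module.End.mul_apply, ih, mulX_powSeries]
    congr 1
    funext a
    congr 1
    push_cast
    ring

lemma ddx_pow_powSeries (k : ℕ) (r : ℤ → S) : (ddx S ^ k) (powSeries δ r) =
    powSeries δ fun a => (∏ s ∈ Finset.range k, (δ + ((a + k - s : ℤ) : S))) * r (a + k) := by
  induction k generalizing r with
  | zero => simp
  | succ k ih =>
    rw [pow_succ, Module.End.mul_apply, ddx_powSeries, ih]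
    congr 1
    funext a
    rw [Finset.prod_range_succ', mul_assoc]
    have h1 : a + ((k + 1 : ℕ) : ℤ) = a + k + 1 := by push_cast; ring
    rw [h1]
    congr 1
    · refine Finset.prod_congr rfl fun s _ => ?_
      congr 2
      push_cast
      ring
    · simp

lemma eulerProd_powSeries {n : ℕ} (l : Fin n → ℤ) :
    (List.ofFn fun s : Fin n => mulX S * ddx S - (l s : Module.End S (LogSeries S))).prod
      (powSeries δ r) = powSeries δ fun a => (∏ s : Fin n, (δ + ((a - l s : ℤ) : S))) * r a := by
  induction n with
  | zero => simp
  | succ n ih =>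
    rw [List.ofFn_succ, List.prod_cons, Module.End.mul_apply, ih (fun s => l s.succ),
      LinearMap.sub_apply, Module.End.mul_apply, ddx_powSeries, mulX_powSeries,
      Module.End.intCast_apply]
    funext a k
    simp only [powSeries, Pi.sub_apply, Pi.smul_apply, sub_add_cancel, Fin.prod_univ_succ]
    rw [zsmul_eq_mul]
    push_cast
    ring

end

section

variable {n : ℕ} (l : Fin n → ℤ) (m : ℕ) {S : Type} [CommRing S] [Algebra RHat S] (δ : S)
  (r : ℤ → S)

lemma opD_powSeries (K : ℕ) (a : ℤ) (k : ℕ) : opD l m S K (powSeries δ r) a k =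
    δ ^ k * ((∏ s : Fin n, (δ + ((a - l s : ℤ) : S))) * r a +
      ∑ j ∈ Finset.range (m + 1), ∑ i ∈ Finset.range K, algebraMap RHat S (t i j) *
        ((∏ s ∈ Finset.range j, (δ + ((a + j - i - s : ℤ) : S))) * r (a + j - i))) := by
  rw [opD, LinearMap.add_apply, eulerProd_powSeries, LinearMap.sum_apply, Pi.add_apply,
    Pi.add_apply, mul_add]
  congr 1
  rw [Finset.sum_apply, Finset.sum_apply, Finset.mul_sum]
  refine Finset.sum_congr rfl fun j _ => ?_
  rw [LinearMap.sum_apply, Finset.sum_apply, Finset.sum_apply, Finset.mul_sum]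
  refine Finset.sum_congr rfl fun i _ => ?_
  rw [LinearMap.smul_apply, Module.End.mul_apply, ddx_pow_powSeries, mulX_pow_powSeries]
  simp only [powSeries, Pi.smul_apply, smul_eq_mul]
  have h1 : a - i + j = a + j - i := by ring
  rw [mul_left_comm, h1]

lemma aeval_entry (a b : ℤ) : Polynomial.aeval δ (entry l m a b) =
    (if a = b then ∏ s : Fin n, (δ + ((b - l s : ℤ) : S)) else 0) +
      ∑ j ∈ Finset.range (m + 1), if 0 ≤ (j : ℤ) + a - b then
        algebraMap RHat S (t ((j : ℤ) + a - b).toNat j) *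
          ∏ s ∈ Finset.range j, (δ + ((b - (s : ℤ) : ℤ) : S)) else 0 := by
  rw [entry, map_add, map_sum]
  congr 1
  · split_ifs <;> simp [map_prod]
  · refine Finset.sum_congr rfl fun j _ => ?_
    split_ifs <;> simp [map_prod]

lemma sum_range_sub {M : Type*} [AddCommMonoid M] (g : ℤ → M) (c : ℤ) (K : ℕ) :
    ∑ i ∈ Finset.range K, g (c - i) = ∑ b ∈ Finset.Ioc (c - K) c, g b := by
  refine Finset.sum_bij' (fun i _ => c - i) (fun b _ => (c - b).toNat) ?_ ?_ ?_ ?_ ?_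
  · intro i hi
    rw [Finset.mem_range] at hi
    rw [Finset.mem_Ioc]
    omega
  · intro b hb
    rw [Finset.mem_Ioc] at hb
    rw [Finset.mem_range]
    omega
  · intro i _
    omega
  · intro b hb
    rw [Finset.mem_Ioc] at hb
    omega
  · intro i _
    rfl

/-- Links the operator to row `a` of `B(δ)`. Once `K > a + m - L` the cut sum contains every column
`b ≥ L`, and its other terms have `r b ∈ J`. -/
theorem opD_powSeries_sub_mem (J : Ideal S) {L a : ℤ} (hL : L ≤ a) (hr : ∀ b < L, r b ∈ J)
    {K : ℕ} (hK : a + m - L < K) (k : ℕ) :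
    opD l m S K (powSeries δ r) a k - δ ^ k * ∑ b ∈ Finset.Icc L (a + (max m 1 : ℕ)),
      Polynomial.aeval δ (entry l m a b) * r b ∈ J := by
  rw [opD_powSeries, ← mul_sub]
  refine Ideal.mul_mem_left _ _ ?_
  simp_rw [aeval_entry, add_mul, Finset.sum_add_distrib, ite_mul, zero_mul]
  rw [Finset.sum_ite_eq, if_pos (by rw [Finset.mem_Icc]; omega), add_sub_add_left_eq_sub]
  simp_rw [Finset.sum_mul]
  rw [Finset.sum_comm (s := Finset.Icc L _), ← Finset.sum_sub_distrib]
  refine Ideal.sum_mem _ fun j hj => ?_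
  rw [Finset.mem_range] at hj
  let g : ℤ → S := fun b => algebraMap RHat S (t (a + j - b).toNat j) *
    ((∏ s ∈ Finset.range j, (δ + ((b - (s : ℤ) : ℤ) : S))) * r b)
  have h1 : ∑ i ∈ Finset.range K, algebraMap RHat S (t i j) *
      ((∏ s ∈ Finset.range j, (δ + ((a + j - i - s : ℤ) : S))) * r (a + j - i)) =
      ∑ b ∈ Finset.Ioc (a + j - K) (a + j), g b := by
    rw [← sum_range_sub]
    refine Finset.sum_congr rfl fun i _ => ?_
    simp only [g]
    rw [show (a + j - (a + j - (i : ℤ))).toNat = i by omega]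
  have h2 : ∑ b ∈ Finset.Icc L (a + (max m 1 : ℕ)), (if 0 ≤ (j : ℤ) + a - b then
      algebraMap RHat S (t ((j : ℤ) + a - b).toNat j) *
          ∏ s ∈ Finset.range j, (δ + ((b - (s : ℤ) : ℤ) : S)) else 0) * r b =
      ∑ b ∈ Finset.Icc L (a + j), g b := by
    have hsub : Finset.Icc L (a + j) ⊆ Finset.Icc L (a + (max m 1 : ℕ)) :=
      Finset.Icc_subset_Icc le_rfl (by omega)
    rw [← Finset.sum_subset hsub]
    · refine Finset.sum_congr rfl fun b hb => ?_
      rw [Finset.mem_Icc] at hb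
      rw [if_pos (by omega), add_comm (j : ℤ) a, mul_assoc]
    · intro b hb hb'
      rw [Finset.mem_Icc] at hb hb'
      rw [if_neg (by omega), zero_mul]
  rw [h1, h2]
  have hsub : Finset.Icc L (a + j) ⊆ Finset.Ioc (a + j - K) (a + j) := by
    intro b hb
    rw [Finset.mem_Icc] at hb
    rw [Finset.mem_Ioc]
    omega
  rw [← Finset.sum_sdiff hsub, add_sub_cancel_right]
  refine Ideal.sum_mem _ fun b hb => Ideal.mul_mem_left _ _ (Ideal.mul_mem_left _ _ (hr b ?_))
  rw [Finset.mem_sdiff, Finset.mem_Ioc, Finset.mem_Icc] at hb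
  omega

end

end PDet

namespace PDet

open Polynomial

/-! ### Existence of solutions -/

lemma aeval_mem_filtIn {S : Type} [CommRing S] [Algebra RHat S] {K : ℕ} {p : RHat[X]}
    (hp : ∀ i, p.coeff i ∈ filt K) (x : S) : aeval x p ∈ filtIn S K := by
  rw [aeval_eq_sum_range]
  refine Ideal.sum_mem _ fun i _ => ?_
  rw [Algebra.smul_def]
  exact Ideal.mul_mem_right _ _ (Ideal.mem_map_of_mem _ (hp i))

lemma filtIn_zero (S : Type) [CommRing S] [Algebra RHat S] : filtIn S 0 = ⊤ := by
  rw [filtIn, isCompleteFiltration_filt.zero, Ideal.map_top]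

variable {n : ℕ} (l : Fin n → ℤ) (m : ℕ)

/-- Makes evaluation at `ε_j` compatible with power series identities modulo `w`: reducing `p`
modulo `w` does not change its value at the root, and the reduced polynomial is small by uniqueness
of division. -/
lemma aeval_root_mem_filtIn (hw : (w l m).IsDistinguishedAt (filt 1)) {K : ℕ}
    {q : PowerSeries RHat} {p : RHat[X]} (h : (w l m : PowerSeries RHat) * q + p ∈ psFilt filt K)
    (j : Fin n) : aeval (root l m j) p ∈ filtIn (RBar l m) K := by
  have hp := modByMonic_add_div p (w l m)
  have hdeg : ∀ i, (w l m).natDegree ≤ i → (p %ₘ w l m).coeff i = 0 := by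
    rw [← degree_lt_iff_coeff_zero, ← degree_eq_natDegree hw.monic.ne_zero]
    exact degree_modByMonic_lt p hw.monic
  have h2 := (psFilt_of_distinguished isCompleteFiltration_filt.toIsFiltration hw (K := K)
    (q := q + ((p /ₘ w l m : RHat[X]) : PowerSeries RHat)) (r := p %ₘ w l m) hdeg (by
      convert h using 1
      conv_rhs => rw [← hp]
      rw [Polynomial.coe_add, Polynomial.coe_mul]
      ring)).2
  rw [← hp, map_add, map_mul, aeval_root_w, zero_mul, add_zero]
  exact aeval_mem_filtIn (coe_mem_psFilt.1 h2) _

lemma aeval_root_derivative_w (j : Fin n) : aeval (root l m j) (derivative (w l m)) =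
    eval (root l m j) (∏ i ∈ Finset.univ.erase j, (X - C (root l m i))) := by
  rw [aeval_def, ← eval_map, ← derivative_map, map_w_eq_prod, derivative_prod_finset,
    eval_finsetSum, Finset.sum_eq_single j]
  · simp
  · intro i _ hij
    rw [eval_mul, eval_prod, Finset.prod_eq_zero (Finset.mem_erase.2 ⟨hij.symm, Finset.mem_univ j⟩)
      (by simp), zero_mul]
  · simp

/-- Sum a relation over `τ ∈ T` for each power of `log x`, then combine these with the coefficients
of `∏_{i ≠ j₀} (X - ε_i)`. This polynomial vanishes at the other roots and equals `w'` at `ε_{j₀}`,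
so the Bezout identity applies. -/
lemma linearIndependent_powSeries {r : Fin n → ℤ → RBar l m} {T : Finset ℤ} {h a b : RHat[X]}
    {d : RHat} (hr : ∀ j, ∑ τ ∈ T, r j τ = aeval (root l m j) h)
    (hd : w l m * a + h * derivative (w l m) * b = C d) {S : Type} [CommRing S]
    (π : RBar l m →+* S) (hπ : ∀ c, c * π (algebraMap RHat (RBar l m) d) = 0 → c = 0) :
    LinearIndependent S (fun j => powSeries (π (root l m j)) (fun a => π (r j a))) := by
  rw [Fintype.linearIndependent_iff]
  intro g hg j₀
  have h1 : ∀ k : ℕ, ∑ j, g j * π (root l m j ^ k * aeval (root l m j) h) = 0 := by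
    intro k
    simp_rw [← hr, map_mul, map_sum, map_pow, Finset.mul_sum]
    rw [Finset.sum_comm]
    refine Finset.sum_eq_zero fun τ _ => ?_
    have := congrFun (congrFun hg τ) k
    rw [Finset.sum_apply, Finset.sum_apply] at this
    exact this
  set p : (RBar l m)[X] := ∏ i ∈ Finset.univ.erase j₀, (X - C (root l m i)) with hp
  have h2 : ∑ j, g j * π (eval (root l m j) p * aeval (root l m j) h) = 0 := by
    have h3 : ∀ j, g j * π (eval (root l m j) p * aeval (root l m j) h) =
        ∑ k ∈ Finset.range (p.natDegree + 1),
          π (p.coeff k) * (g j * π (root l m j ^ k * aeval (root l m j) h)) := by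
      intro j
      rw [eval_eq_sum_range, Finset.sum_mul, map_sum, Finset.mul_sum]
      refine Finset.sum_congr rfl fun k _ => ?_
      rw [mul_assoc, map_mul, mul_left_comm]
    simp_rw [h3]
    rw [Finset.sum_comm]
    refine Finset.sum_eq_zero fun k _ => ?_
    rw [← Finset.mul_sum, h1, mul_zero]
  rw [Finset.sum_eq_single j₀, ← aeval_root_derivative_w] at h2
  · refine hπ _ ?_
    have h3 := congrArg (aeval (root l m j₀)) hd
    rw [map_add, map_mul, aeval_root_w, zero_mul, zero_add, map_mul, map_mul, aeval_C] at h3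
    rw [← h3, map_mul π, ← mul_assoc, mul_comm (aeval (root l m j₀) h), h2, zero_mul]
  · intro j _ hj
    rw [hp, eval_prod, Finset.prod_eq_zero (Finset.mem_erase.2 ⟨hj, Finset.mem_univ j⟩) (by simp),
      zero_mul, map_zero, mul_zero]
  · simp

theorem exists_solutions : ∃ r : Fin n → ℤ → RBar l m,
    (∀ j, IsSolution l m (powSeries (root l m j) (r j))) ∧
    LinearIndependent (RBar l m) (fun j => powSeries (root l m j) (r j)) ∧
    (∃ C : ℝ, ∀ (j : Fin n) (a : ℤ),
      r j a ∈ filtIn (RBar l m) ⌈(C - (a : ℝ)) / ((max m 1 : ℕ) : ℝ)⌉₊) ∧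
    (∀ P : Ideal (RBar l m), P.IsPrime → P.comap (algebraMap RHat (RBar l m)) = ⊥ →
      LinearIndependent (RBar l m ⧸ P)
        (fun j => powSeries (Ideal.Quotient.mk P (root l m j))
          (fun a => Ideal.Quotient.mk P (r j a)))) := by
  have hF := isCompleteFiltration_filt
  obtain ⟨C₀, v, E, u, hvE, hw, hwn, -, hdet⟩ := exists_isReduction_entryPS l m
  choose qt rm hqr hrm using exists_weierstrass_division hF filt_one_ne_top
    (hasWeierstrassDegree_of_distinguished hw)
  -- This is `adj(E)` applied to the all-ones vector, so that `E y` has every entry equal to `det E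
  -- = w * u`.
  set y : resonances l → PowerSeries RHat := fun τ => ∑ τ', E.adjugate τ τ' with hy
  set V : ℤ → PowerSeries RHat := fun a => ∑ τ, v τ a * y τ with hV
  have hVdecay : ∀ (k : ℕ) (i : ℤ), i + k * (max m 1 : ℕ) < C₀ → V i ∈ psFilt filt k :=
    fun k i hi => Ideal.sum_mem _ fun τ _ => Ideal.mul_mem_right _ _ (hvE.decay τ k i hi)
  have hEy : ∀ τ', ∑ τ, E τ' τ * y τ = w l m * u := by
    intro τ'
    simp_rw [hy, Finset.mul_sum]
    rw [Finset.sum_comm]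
    have h1 : ∀ τ'', ∑ τ, E τ' τ * E.adjugate τ τ'' =
        (E.det • (1 : Matrix (resonances l) (resonances l) (PowerSeries RHat))) τ' τ'' := by
      intro τ''
      rw [← Matrix.mul_adjugate, Matrix.mul_apply]
    simp_rw [h1, Matrix.smul_apply, Matrix.one_apply]
    simp [hdet]
  have hVrow : ∀ (K : ℕ) (i : ℤ), ∃ c : PowerSeries RHat, ∃ L₀, ∀ L ≤ L₀,
      ∑ b ∈ Finset.Icc L (i + (max m 1 : ℕ)), entryPS l m i b * V b - w l m * c ∈
        psFilt filt K := by
    intro K i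
    choose L₀ hL₀ using hvE.rows K i
    have hbdd : ∃ L₁, ∀ τ, L₁ ≤ L₀ τ := by
      obtain ⟨L₁, hL₁⟩ := (Set.finite_range L₀).bddBelow
      exact ⟨L₁, fun τ => hL₁ (Set.mem_range_self τ)⟩
    obtain ⟨L₁, hL₁⟩ := hbdd
    refine ⟨if i ∈ resonances l then u else 0, L₁, fun L hL => ?_⟩
    have h1 := Ideal.sum_mem (psFilt filt K) (t := Finset.univ)
      (f := fun τ => (∑ b ∈ Finset.Icc L (i + (max m 1 : ℕ)), entryPS l m i b * v τ b -
        if h : i ∈ resonances l then E ⟨i, h⟩ τ else 0) * y τ)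
      (fun τ _ => Ideal.mul_mem_right _ _ (hL₀ τ L (hL.trans (hL₁ τ))))
    convert h1 using 1
    simp_rw [sub_mul, Finset.sum_sub_distrib]
    congr 1
    · simp_rw [hV, Finset.mul_sum, Finset.sum_mul]
      rw [Finset.sum_comm]
      simp_rw [mul_assoc]
    · split_ifs with hi
      · exact (hEy ⟨i, hi⟩).symm
      · simp
  -- On `T` the column `V` is `y`, and remainders are additive by uniqueness of division.
  have hsum : ∑ τ : resonances l, rm (V τ) = rm (∑ τ, y τ) := by
    have h1 : ∑ τ : resonances l, V τ = ∑ τ, y τ := by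
      refine Finset.sum_congr rfl fun τ' _ => ?_
      simp_rw [hV, hvE.ident]
      simp
    have h2 : (w l m : PowerSeries RHat) * (∑ τ : resonances l, qt (V τ) - qt (∑ τ, y τ)) +
        ((∑ τ : resonances l, rm (V τ) - rm (∑ τ, y τ) : RHat[X]) : PowerSeries RHat) = 0 := by
      have h3 : ((∑ τ : resonances l, rm (V τ) : RHat[X]) : PowerSeries RHat) =
          ∑ τ : resonances l, (rm (V τ) : PowerSeries RHat) := by
        simp_rw [← Polynomial.coeToPowerSeries.ringHom_apply, map_sum]
      have h4 : ∑ τ : resonances l, V τ = ∑ τ : resonances l,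
          ((w l m : PowerSeries RHat) * qt (V τ) + rm (V τ)) :=
        Finset.sum_congr rfl fun τ _ => hqr _
      rw [Finset.sum_add_distrib, ← Finset.mul_sum, ← h3, h1] at h4
      have h5 := hqr (∑ τ, y τ)
      rw [Polynomial.coe_sub, mul_sub, sub_add_sub_comm, ← h4, ← h5, sub_self]
    refine Polynomial.ext fun i => sub_eq_zero.1 (hF.separated fun K => ?_)
    have h3 := (psFilt_of_distinguished hF.toIsFiltration hw (K := K)
      (q := ∑ τ : resonances l, qt (V τ) - qt (∑ τ, y τ))
      (r := ∑ τ : resonances l, rm (V τ) - rm (∑ τ, y τ)) (fun i hi => by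
        rw [coeff_sub, finsetSum_coeff, hrm _ _ hi, Finset.sum_eq_zero (fun τ _ => hrm _ _ hi),
          sub_zero]) (by rw [h2]; exact zero_mem _)).2
    simpa using coe_mem_psFilt.1 h3 i
  obtain ⟨d, hd0, a, b, hd⟩ := exists_bezout l m hvE hw hwn hdet (h := rm (∑ τ, y τ))
    (fun i hi => hrm _ _ (hwn.le.trans hi)) (hqr (∑ τ, y τ))
  let r : Fin n → ℤ → RBar l m := fun j a => aeval (root l m j) (rm (V a))
  have hrdecay : ∀ (j : Fin n) (k : ℕ) (i : ℤ), i + k * (max m 1 : ℕ) < C₀ →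
      r j i ∈ filtIn (RBar l m) k := fun j k i hi =>
    aeval_root_mem_filtIn l m hw (q := qt (V i)) (by rw [← hqr]; exact hVdecay k i hi) j
  have hrsum : ∀ j, ∑ τ ∈ resonances l, r j τ = aeval (root l m j) (rm (∑ τ, y τ)) := by
    intro j
    rw [← hsum, map_sum, ← Finset.sum_coe_sort]
  refine ⟨r, fun j => ?_, ?_, ?_, fun P hP hP0 => ?_⟩
  · intro i k N
    obtain ⟨c, L₀, hL₀⟩ := hVrow N i
    set L := min (min L₀ i) (C₀ - N * (max m 1 : ℕ)) with hL
    have hr : ∀ b < L, r j b ∈ filtIn (RBar l m) N := fun b hb => hrdecay j N b (by omega)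
    refine ⟨(i + m - L + 1).toNat, fun K hK => ?_⟩
    have h1 := opD_powSeries_sub_mem l m (root l m j) (r j) (filtIn (RBar l m) N) (L := L) (a := i)
      (by omega) hr (K := K) (by omega) k
    have h2 : ∑ b ∈ Finset.Icc L (i + (max m 1 : ℕ)), aeval (root l m j) (entry l m i b) * r j b ∈
        filtIn (RBar l m) N := by
      have h3 := aeval_root_mem_filtIn l m hw (K := N)
        (q := ∑ b ∈ Finset.Icc L (i + (max m 1 : ℕ)), entryPS l m i b * qt (V b) - c)
        (p := ∑ b ∈ Finset.Icc L (i + (max m 1 : ℕ)), entry l m i b * rm (V b)) (by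
          convert hL₀ L (by omega) using 1
          have h4 : ((∑ b ∈ Finset.Icc L (i + (max m 1 : ℕ)), entry l m i b * rm (V b) :
              RHat[X]) : PowerSeries RHat) =
              ∑ b ∈ Finset.Icc L (i + (max m 1 : ℕ)), entryPS l m i b * rm (V b) := by
            simp_rw [entryPS, ← Polynomial.coeToPowerSeries.ringHom_apply, map_sum, map_mul]
          rw [h4, mul_sub, sub_add_eq_add_sub, Finset.mul_sum, ← Finset.sum_add_distrib]
          congr 1
          refine Finset.sum_congr rfl fun b _ => ?_
          conv_rhs => rw [hqr (V b)]
          ring) j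
      rw [map_sum] at h3
      simpa using h3
    have := add_mem h1 (Ideal.mul_mem_left _ (root l m j ^ k) h2)
    rwa [sub_add_cancel] at this
  · refine linearIndependent_powSeries l m hrsum hd (RingHom.id _) fun c hc => ?_
    rw [mul_comm] at hc
    exact eq_zero_of_algebraMap_mul_eq_zero l m hw.monic hwn hd0 hc
  -- The shift by one band width absorbs the rounding of the ceiling: `k - 1` lies strictly below
  -- the quotient, which yields `i + k * max m 1 < C₀`.
  · refine ⟨C₀ - (max m 1 : ℕ), fun j i => ?_⟩
    have hm : (0 : ℝ) < (max m 1 : ℕ) := by positivity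
    set k := ⌈((C₀ : ℝ) - (max m 1 : ℕ) - i) / (max m 1 : ℕ)⌉₊ with hk
    rcases Nat.eq_zero_or_pos k with h0 | hpos
    · rw [h0, filtIn_zero]
      trivial
    · refine hrdecay j k i ?_
      have h1 : ((k - 1 : ℕ) : ℝ) < ((C₀ : ℝ) - (max m 1 : ℕ) - i) / (max m 1 : ℕ) :=
        Nat.lt_ceil.1 (by omega)
      rw [lt_div_iff₀ hm, Nat.cast_sub hpos] at h1
      have h2 : (i : ℝ) + k * (max m 1 : ℕ) < C₀ := by push_cast at h1 ⊢; linarith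
      exact_mod_cast h2
  · refine linearIndependent_powSeries l m hrsum hd (Ideal.Quotient.mk P) fun c hc => ?_
    refine (mul_eq_zero.1 hc).resolve_right fun h => hd0 ?_
    have : d ∈ P.comap (algebraMap RHat (RBar l m)) :=
      Ideal.mem_comap.2 (Ideal.Quotient.eq_zero_iff_mem.1 h)
    rwa [hP0, Ideal.mem_bot] at this

end PDet

namespace PDet

open Polynomial

/-! ### Exponents of solutions -/

section Reduction

variable {B : Type*} [CommRing B] {F : ℕ → Ideal B} {b : ℤ → ℤ → B} {m : ℕ} {T : Finset ℤ}

/-- Meant for the quotient `S / I^N S`, where decay means vanishing far to the left. The difference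
of the two sides vanishes there and on `T` and satisfies the remaining rows, so the main estimate
kills it. The rows of `T` give `E r = 0`, and the adjugate yields `det E`. -/
lemma IsReduction.eq_sum_of_rows (hb : IsAlmostLower F b m T) (hF : IsFiltration F) {N : ℕ}
    (hN : F N = ⊥) {C : ℤ} {v : T → ℤ → B} {E : Matrix T T B} (hvE : IsReduction F b m T C v E)
    {r : ℤ → B} {L₀ : ℤ} (hr : ∀ i < L₀, r i = 0)
    (hrow : ∀ i : ℤ, ∃ L₁ : ℤ, ∀ L ≤ L₁, ∑ j ∈ Finset.Icc L (i + m), b i j * r j = 0) :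
    (∀ i, r i = ∑ τ : T, r τ * v τ i) ∧ ∀ τ : T, E.det * r τ = 0 := by
  have hrows : ∀ i : ℤ, ∃ L₁ : ℤ, ∀ L ≤ L₁, ∑ j ∈ Finset.Icc L (i + m), b i j * ∑ τ : T, r τ * v τ j =
      ∑ τ : T, r τ * if h : i ∈ T then E ⟨i, h⟩ τ else 0 := by
    intro i
    choose L₁ hL₁ using hvE.rows N i
    obtain ⟨L₂, hL₂⟩ := (Set.finite_range L₁).bddBelow
    refine ⟨L₂, fun L hL => ?_⟩
    simp_rw [Finset.mul_sum]
    rw [Finset.sum_comm]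
    refine Finset.sum_congr rfl fun τ _ => ?_
    have := hL₁ τ L (hL.trans (hL₂ (Set.mem_range_self τ)))
    rw [hN, Ideal.mem_bot, sub_eq_zero] at this
    rw [← this, Finset.mul_sum]
    exact Finset.sum_congr rfl fun j _ => mul_left_comm _ _ _
  have heq : ∀ i, r i = ∑ τ : T, r τ * v τ i := by
    intro i
    -- The equations hold in all rows, so the bound is free; this value just reaches index `i`.
    have := hb.mem_of_rows hF (C := i + N * m + 1) (K := N)
      (z := fun i => r i - ∑ τ : T, r τ * v τ i) (L₀ := min L₀ (C - N * m)) ?_ ?_ N le_rfl i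
      (by omega)
    · rwa [hN, Ideal.mem_bot, sub_eq_zero] at this
    · intro i hi
      rw [hr i (by omega), zero_sub, neg_mem_iff]
      exact Ideal.sum_mem _ fun τ _ => Ideal.mul_mem_left _ _ (hvE.decay τ N i (by omega))
    · intro k _ i _
      by_cases hi : i ∈ T
      · left
        have h1 : ∑ τ : T, r τ * v τ i = r i := by
          rw [Finset.sum_eq_single ⟨i, hi⟩]
          · have := hvE.ident ⟨i, hi⟩ ⟨i, hi⟩
            rw [if_pos rfl] at this
            rw [this, mul_one]
          · intro τ _ hτ
            have := hvE.ident τ ⟨i, hi⟩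
            rw [if_neg hτ.symm] at this
            rw [this, mul_zero]
          · simp
        rw [h1, sub_self]
        exact zero_mem _
      · right
        obtain ⟨L₁, hL₁⟩ := hrow i
        obtain ⟨L₂, hL₂⟩ := hrows i
        refine ⟨hi, min i (min L₁ L₂), min_le_left _ _, ?_⟩
        simp_rw [mul_sub]
        rw [Finset.sum_sub_distrib, hL₁ _ (by omega), hL₂ _ (by omega)]
        simp [hi]
  refine ⟨heq, fun τ => ?_⟩
  have hE : E.mulVec (fun τ : T => r τ) = 0 := by
    funext τ'
    obtain ⟨L₁, hL₁⟩ := hrow τ'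
    obtain ⟨L₂, hL₂⟩ := hrows τ'
    have h1 := hL₁ (min L₁ L₂) (min_le_left _ _)
    have h2 := hL₂ (min L₁ L₂) (min_le_right _ _)
    simp_rw [← heq] at h2
    rw [h1] at h2
    rw [Matrix.mulVec, dotProduct, Pi.zero_apply, h2]
    refine Finset.sum_congr rfl fun τ _ => ?_
    rw [dif_pos τ'.2, mul_comm]
  have h3 : (E.adjugate * E).mulVec (fun τ : T => r τ) = 0 := by
    rw [← Matrix.mulVec_mulVec, hE, Matrix.mulVec_zero]
  rw [Matrix.adjugate_mul, Matrix.smul_mulVec, Matrix.one_mulVec] at h3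
  exact congrFun h3 τ

end Reduction

/-! ### Evaluation of power series at nilpotent elements -/

section Eval

variable {A Q : Type*} [CommRing A] [CommRing Q] (ρ : A →+* Q) {δ : Q} {e : ℕ}

lemma eval₂_congr_of_pow_eq_zero (he : δ ^ e = 0) {p q : A[X]}
    (h : ∀ i < e, p.coeff i = q.coeff i) : p.eval₂ ρ δ = q.eval₂ ρ δ := by
  obtain ⟨g, hg⟩ : X ^ e ∣ p - q := by
    rw [X_pow_dvd_iff]
    intro i hi
    rw [coeff_sub, h i hi, sub_self]
  rw [← sub_eq_zero, ← eval₂_sub, hg, eval₂_mul, eval₂_X_pow, he, zero_mul]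

/-- Evaluation of power series at a nilpotent element. -/
noncomputable def nilpotentEval (he : δ ^ e = 0) : PowerSeries A →+* Q where
  toFun f := (f.trunc e).eval₂ ρ δ
  map_one' := by
    rw [eval₂_congr_of_pow_eq_zero ρ he (q := 1), eval₂_one]
    intro i hi
    rw [PowerSeries.coeff_trunc, if_pos hi, PowerSeries.coeff_one, coeff_one]
  map_zero' := by simp
  map_add' f g := by rw [map_add, eval₂_add]
  map_mul' f g := by
    rw [← eval₂_mul]
    refine eval₂_congr_of_pow_eq_zero ρ he fun i hi => ?_
    rw [PowerSeries.coeff_trunc, if_pos hi, PowerSeries.coeff_mul, coeff_mul]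
    refine Finset.sum_congr rfl fun p hp => ?_
    rw [Finset.HasAntidiagonal.mem_antidiagonal] at hp
    rw [PowerSeries.coeff_trunc, PowerSeries.coeff_trunc, if_pos (by omega), if_pos (by omega)]

lemma nilpotentEval_coe (he : δ ^ e = 0) (p : A[X]) :
    nilpotentEval ρ he (p : PowerSeries A) = p.eval₂ ρ δ :=
  eval₂_congr_of_pow_eq_zero ρ he fun i hi => by
    rw [PowerSeries.coeff_trunc, if_pos hi, Polynomial.coeff_coe]

lemma nilpotentEval_mem {F : ℕ → Ideal A} (he : δ ^ e = 0) {k : ℕ} {f : PowerSeries A}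
    (hf : f ∈ psFilt F k) : nilpotentEval ρ he f ∈ (F k).map ρ := by
  change (f.trunc e).eval₂ ρ δ ∈ _
  rw [eval₂_eq_sum_range]
  refine Ideal.sum_mem _ fun i _ => Ideal.mul_mem_right _ _ (Ideal.mem_map_of_mem _ ?_)
  rw [PowerSeries.coeff_trunc]
  split_ifs
  · exact hf i
  · exact zero_mem _

lemma IsFiltration.map {F : ℕ → Ideal A} (hF : IsFiltration F) :
    IsFiltration fun k => (F k).map ρ where
  zero := by simp only [hF.zero, Ideal.map_top]
  anti i j hij := Ideal.map_mono (hF.anti hij)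
  mul_mem {i j x y} hx hy := by
    have h1 : F i * F j ≤ F (i + j) := Ideal.mul_le.2 fun x hx y hy => hF.mul_mem hx hy
    have h2 := Ideal.mul_mem_mul hx hy
    rw [← Ideal.map_mul] at h2
    exact Ideal.map_mono h1 h2

end Eval

/-- A nonzero `x` divides some nonzero `a ∈ RHat`, which then lies in every `filtIn S N`. By
Cayley–Hamilton for multiplication by `a`, `a ^ D ∈ filt N` with `D` independent of `N`, so `a ^ D =
0`. No Noetherian hypothesis is involved. -/
lemma eq_zero_of_forall_mem_filtIn {S : Type} [CommRing S] [IsDomain S] [Algebra RHat S]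
    [Module.Finite RHat S] (hinj : Function.Injective (algebraMap RHat S)) {x : S}
    (hx : ∀ N, x ∈ filtIn S N) : x = 0 := by
  by_contra hx0
  have hF := isCompleteFiltration_filt
  have halg : IsAlgebraic RHat x := (Algebra.IsIntegral.isIntegral x).isAlgebraic
  obtain ⟨a, ha0, ha⟩ := halg.exists_nonzero_dvd (mem_nonZeroDivisors_of_ne_zero hx0)
  have hmem : ∀ N, algebraMap RHat S a ∈ filtIn S N := fun N => by
    obtain ⟨c, hc⟩ := ha
    rw [hc]
    exact Ideal.mul_mem_right _ _ (hx N)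
  set D := (⊤ : Submodule RHat S).spanFinrank
  refine pow_ne_zero D ha0 (hF.separated fun N => ?_)
  obtain ⟨p, hp, hpD, hpI, hp0⟩ :=
    LinearMap.exists_monic_and_natDegree_eq_and_coeff_mem_pow_and_aeval_eq_zero RHat
      (algebraMap RHat (Module.End RHat S) a) (filt N) (by
        rintro _ ⟨s, rfl⟩
        rw [Ideal.smul_top_eq_map, Module.algebraMap_end_apply, Algebra.smul_def]
        exact Ideal.mul_mem_right _ _ (hmem N))
  rw [aeval_algebraMap_apply_eq_algebraMap_eval] at hp0
  have h1 : p.eval a = 0 := by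
    apply hinj
    have h2 := LinearMap.congr_fun hp0 (1 : S)
    rwa [Module.algebraMap_end_apply, Algebra.smul_def, mul_one, LinearMap.zero_apply,
      ← map_zero (algebraMap RHat S)] at h2
  rw [eval_eq_sum_range, Finset.sum_range_succ, hp.coeff_natDegree, one_mul, hpD] at h1
  rw [eq_neg_of_add_eq_zero_right h1, neg_mem_iff]
  refine Ideal.sum_mem _ fun k hk => Ideal.mul_mem_right _ _ ?_
  rw [Finset.mem_range] at hk
  exact Ideal.pow_le_self (by omega) (hpI k)

variable {n : ℕ} (l : Fin n → ℤ) (m : ℕ)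

/-- Modulo `filtIn S N` the exponent is nilpotent and `r` vanishes far to the left, so the reduction
can be evaluated at `δ` and `IsReduction.eq_sum_of_rows` applies; the unit `u` is then cancelled. -/
lemma exponent_mul_mem {S : Type} [CommRing S] [Algebra RHat S] {C : ℤ}
    {v : resonances l → ℤ → PowerSeries RHat}
    {E : Matrix (resonances l) (resonances l) (PowerSeries RHat)} {u : PowerSeries RHat}
    (hvE : IsReduction (psFilt filt) (entryPS l m) (max m 1) (resonances l) C v E)
    (hu : IsUnit u) (hdet : E.det = (w l m : PowerSeries RHat) * u) {δ : S} {r : ℤ → S}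
    (hδ : δ ∈ (filtIn S 1).radical) (hr : ∀ N, ∃ L, ∀ a < L, r a ∈ filtIn S N)
    (hsol : IsSolution l m (powSeries δ r)) (N : ℕ) :
    (∀ τ ∈ resonances l, aeval δ (w l m) * r τ ∈ filtIn S N) ∧
      ((∀ τ ∈ resonances l, r τ = 0) → ∀ a, r a ∈ filtIn S N) := by
  have hF := isCompleteFiltration_filt.toIsFiltration
  have hFS : IsFiltration (filtIn S) := hF.map (algebraMap RHat S)
  let π : S →+* S ⧸ filtIn S N := Ideal.Quotient.mk _
  let ρ : RHat →+* S ⧸ filtIn S N := π.comp (algebraMap RHat S)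
  have hπ : ∀ x, π x = 0 ↔ x ∈ filtIn S N := fun x => Ideal.Quotient.eq_zero_iff_mem
  obtain ⟨e, he⟩ : ∃ e, π δ ^ e = 0 := by
    obtain ⟨e, he⟩ := hδ
    refine ⟨e * N, ?_⟩
    rw [← map_pow, hπ, pow_mul]
    exact hFS.pow_le N (Ideal.pow_mem_pow he N)
  have hG := hF.map ρ
  have hGN : (filt N).map ρ = ⊥ := by
    have h1 : (filt N).map ρ = ((filt N).map (algebraMap RHat S)).map π := (Ideal.map_map _ _).symm
    rw [h1]
    exact Ideal.map_quotient_self _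
  let ev := nilpotentEval ρ he
  have hev : ∀ {k f}, f ∈ psFilt filt k → ev f ∈ (filt k).map ρ :=
    fun hf => nilpotentEval_mem ρ he hf
  have hevp : ∀ p : RHat[X], ev (p : PowerSeries RHat) = π (aeval δ p) := by
    intro p
    rw [aeval_def, hom_eval₂]
    exact nilpotentEval_coe ρ he p
  have hlow := isAlmostLower_entryPS l m
  have hlow' : IsAlmostLower (fun k => (filt k).map ρ) (fun i j => ev (entryPS l m i j))
      (max m 1) (resonances l) :=
    { pos := hlow.pos
      small := fun hij => hev (hlow.small hij)
      eq_zero := fun hij => by rw [hlow.eq_zero hij, map_zero]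
      isUnit := fun hi => (hlow.isUnit hi).map ev }
  have hvE' : IsReduction (fun k => (filt k).map ρ) (fun i j => ev (entryPS l m i j))
      (max m 1) (resonances l) C (fun τ i => ev (v τ i)) (ev.mapMatrix E) :=
    { ident := fun τ τ' => by
        rw [hvE.ident]
        split_ifs <;> simp
      decay := fun τ k i hi => hev (hvE.decay τ k i hi)
      rows := fun K i τ => by
        obtain ⟨L₀, hL₀⟩ := hvE.rows K i τ
        refine ⟨L₀, fun L hL => ?_⟩
        convert hev (hL₀ L hL) using 1
        rw [map_sub, map_sum]
        congr 1
        · simp_rw [map_mul]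
        · split_ifs
          · rfl
          · rw [map_zero] }
  obtain ⟨L₀, hL₀⟩ := hr N
  obtain ⟨h1, h2⟩ := hvE'.eq_sum_of_rows hlow' hG hGN (r := fun i => π (r i)) (L₀ := L₀)
    (fun i hi => (hπ _).2 (hL₀ i hi)) (by
      intro i
      refine ⟨min i L₀, fun L hL => ?_⟩
      obtain ⟨K₀, hK₀⟩ := hsol i 0 N
      set K := max K₀ (i + m - L + 1).toNat with hK
      have h3 := opD_powSeries_sub_mem l m δ r (filtIn S N) (L := L) (a := i) (by omega)
        (fun b hb => hL₀ b (by omega)) (K := K) (by omega) 0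
      have h4 := (filtIn S N).sub_mem (hK₀ K (le_max_left _ _)) h3
      rw [sub_sub_cancel, pow_zero, one_mul, ← hπ, map_sum] at h4
      rw [← h4]
      refine Finset.sum_congr rfl fun j _ => ?_
      rw [map_mul, entryPS, hevp])
  constructor
  · intro τ hτ
    have h3 := h2 ⟨τ, hτ⟩
    rw [← RingHom.map_det, hdet, map_mul, hevp, mul_right_comm] at h3
    have h4 := (hu.map ev).mul_left_eq_zero.1 h3
    rwa [← map_mul, hπ] at h4
  · intro hT a
    have h3 : π (r a) = 0 := by
      rw [h1 a]
      refine Finset.sum_eq_zero fun τ _ => ?_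
      rw [hT τ τ.2, map_zero, zero_mul]
    exact (hπ _).1 h3

theorem exponent_eq_root (P : Ideal (RBar l m)) [P.IsPrime]
    (hP : P.comap (algebraMap RHat (RBar l m)) = ⊥) (δ : RBar l m ⧸ P) (r : ℤ → RBar l m ⧸ P)
    (hδ : δ ∈ (filtIn (RBar l m ⧸ P) 1).radical)
    (hr : ∃ C₁ C₂ C₃ : ℝ, 0 < C₁ ∧ 0 < C₂ ∧ 0 < C₃ ∧ ∀ a : ℤ, (a : ℝ) < -C₃ →
      r a ∈ filtIn (RBar l m ⧸ P) ⌈C₂ - C₁ * (a : ℝ)⌉₊)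
    (hsol : IsSolution l m (powSeries δ r)) (hne : powSeries δ r ≠ 0) :
    ∃ j : Fin n, δ = Ideal.Quotient.mk P (root l m j) := by
  obtain ⟨C₀, v, E, u, hvE, hw, hwn, hu, hdet⟩ := exists_isReduction_entryPS l m
  have hfin : Module.Finite RHat (RBar l m) := finite_rBar l m hw.monic
  have hfin' : Module.Finite RHat (RBar l m ⧸ P) := Module.Finite.of_surjective
    (Ideal.Quotient.mkₐ RHat P).toLinearMap (Ideal.Quotient.mkₐ_surjective RHat P)
  have hinj : Function.Injective (algebraMap RHat (RBar l m ⧸ P)) := by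
    rw [injective_iff_map_eq_zero]
    intro a ha
    have h1 : a ∈ P.comap (algebraMap RHat (RBar l m)) :=
      Ideal.mem_comap.2 (Ideal.Quotient.eq_zero_iff_mem.1 ha)
    rwa [hP, Ideal.mem_bot] at h1
  have hFS : IsFiltration (filtIn (RBar l m ⧸ P)) :=
    isCompleteFiltration_filt.toIsFiltration.map (algebraMap RHat (RBar l m ⧸ P))
  have hbelow : ∀ N, ∃ L, ∀ a < L, r a ∈ filtIn (RBar l m ⧸ P) N := by
    intro N
    obtain ⟨C₁, C₂, C₃, hC₁, -, -, h⟩ := hr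
    -- At `(C₂ - N) / C₁` the exponent `C₂ - C₁ a` reaches `N`.
    refine ⟨⌊min (-C₃) ((C₂ - N) / C₁)⌋, fun a ha => ?_⟩
    have h1 : (a : ℝ) < min (-C₃) ((C₂ - N) / C₁) :=
      lt_of_lt_of_le (by exact_mod_cast ha) (Int.floor_le _)
    rw [lt_min_iff, lt_div_iff₀ hC₁] at h1
    refine hFS.anti ?_ (h a h1.1)
    have h2 : (N : ℝ) ≤ C₂ - C₁ * a := by linarith
    exact_mod_cast h2.trans (Nat.le_ceil _)
  have key := exponent_mul_mem l m hvE hu hdet hδ hbelow hsol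
  -- Otherwise separatedness makes every `r τ`, `τ ∈ T`, vanish, and with them the whole solution.
  have hw0 : aeval δ (w l m) = 0 := by
    by_contra hw0
    have hT : ∀ τ ∈ resonances l, r τ = 0 := fun τ hτ =>
      (mul_eq_zero.1 (eq_zero_of_forall_mem_filtIn hinj fun N => (key N).1 τ hτ)).resolve_left hw0
    apply hne
    funext a k
    change δ ^ k * r a = 0
    rw [eq_zero_of_forall_mem_filtIn hinj fun N => (key N).2 hT a, mul_zero]
  have hmap : (w l m).map (algebraMap RHat (RBar l m ⧸ P)) =
      ∏ j : Fin n, (X - C (Ideal.Quotient.mk P (root l m j))) := by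
    have h1 : algebraMap RHat (RBar l m ⧸ P) =
      (Ideal.Quotient.mk P).comp (algebraMap RHat (RBar l m)) := rfl
    rw [h1, ← Polynomial.map_map, map_w_eq_prod, Polynomial.map_prod]
    simp
  rw [aeval_def, ← eval_map, hmap, eval_prod, Finset.prod_eq_zero_iff] at hw0
  obtain ⟨j, -, hj⟩ := hw0
  refine ⟨j, sub_eq_zero.1 ?_⟩
  simpa using hj

end PDet

theorem lemma6 (n m : ℕ) (l : Fin n → ℤ) :
    (∃ r : Fin n → ℤ → PDet.RBar l m,
      (∀ j, PDet.IsSolution l m (PDet.powSeries (PDet.root l m j) (r j))) ∧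
      LinearIndependent (PDet.RBar l m)
        (fun j => PDet.powSeries (PDet.root l m j) (r j)) ∧
      (∃ C : ℝ, ∀ (j : Fin n) (a : ℤ),
        r j a ∈ PDet.filtIn (PDet.RBar l m) ⌈(C - (a : ℝ)) / ((max m 1 : ℕ) : ℝ)⌉₊) ∧
      (∀ P : Ideal (PDet.RBar l m), P.IsPrime →
        P.comap (algebraMap PDet.RHat (PDet.RBar l m)) = ⊥ →
        LinearIndependent (PDet.RBar l m ⧸ P)
          (fun j => PDet.powSeries (Ideal.Quotient.mk P (PDet.root l m j))
            (fun a => Ideal.Quotient.mk P (r j a))))) ∧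
    (∀ P : Ideal (PDet.RBar l m), P.IsPrime →
      P.comap (algebraMap PDet.RHat (PDet.RBar l m)) = ⊥ →
      ∀ (δ : PDet.RBar l m ⧸ P) (r : ℤ → PDet.RBar l m ⧸ P),
        δ ∈ (PDet.filtIn (PDet.RBar l m ⧸ P) 1).radical →
        (∃ C₁ C₂ C₃ : ℝ, 0 < C₁ ∧ 0 < C₂ ∧ 0 < C₃ ∧ ∀ a : ℤ, (a : ℝ) < -C₃ →
          r a ∈ PDet.filtIn (PDet.RBar l m ⧸ P) ⌈C₂ - C₁ * (a : ℝ)⌉₊) →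
        PDet.IsSolution l m (PDet.powSeries δ r) →
        PDet.powSeries δ r ≠ 0 →
        ∃ j : Fin n, δ = Ideal.Quotient.mk P (PDet.root l m j)) := by
  refine ⟨PDet.exists_solutions l m, fun P hP hP0 δ r hδ hr hsol hne => ?_⟩
  exact PDet.exponent_eq_root l m P hP0 δ r hδ hr hsol hne
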